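/- Let $X$ be a locally compact Hausdorff space and let $\Sigma=(X,\sigma)$ be a singly generated dynamical system, i.e. $\sigma\colon U\to X$ is a local homeomorphism defined on an open subset $U\subseteq X$. For $\xi,\eta\in C_c(U)$ put $\langle\xi,\eta\rangle(x)=\sum_{y\in U,\,\sigma(y)=x}\overline{\xi(y)}\,\eta(y)$, which defines an element of $C_c(X)$. Let $C^*(\Sigma)$ be the universal $C^*$-algebra generated by the images of a $*$-homomorphism $t^0\colon C_0(X)\to C^*(\Sigma)$ and a linear map $t^1\colon C_c(U)\to C^*(\Sigma)$ satisfying (i) $t^1(\xi)^*t^1(\eta)=t^0(\langle\xi,\eta\rangle)$ for all $\xi,\eta\in C_c(U)$, and (ii) $t^1(\xi)t^1(\eta)^*=t^0(\xi\overline{\eta})$ for all $\xi,\eta\in C_c(V)$ whenever $V\subseteq U$ is open and $\sigma|_V$ is injective. The gauge action $\beta$ of $\mathbb{T}=\{z\in\mathbb{C}:|z|=1\}$ on $C^*(\Sigma)$ is determined by $\beta_z(t^0(f))=t^0(f)$ and $\beta_z(t^1(\xi))=z\,t^1(\xi)$. By an ideal we mean a closed two-sided ideal; an ideal $I$ of $C^*(\Sigma)$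 is gauge-invariant if $\beta_z(I)=I$ for all $z\in\mathbb{T}$. A subset $X'\subseteq X$ is $\sigma$-invariant if for all $x\in U$ one has $x\in X'$ if and only if $\sigma(x)\in X'$. For every ideal $I$ of $C^*(\Sigma)$ there is a unique closed subset $X_I\subseteq X$ with $$t^0\bigl(C_0(X\setminus X_I)\bigr)=t^0\bigl(C_0(X)\bigr)\cap I,$$ where $C_0(X\setminus X_I)$ is identified with the set of all functions in $C_0(X)$ vanishing on $X_I$. For a closed $\sigma$-invariant subset $X'\subseteq X$ let $\Sigma'=(X',\sigma|_{X'\cap U})$, with universal pair $(t'^0,t'^1)$, and let $I_{X'}$ be the kernel of the $*$-homomorphism $C^*(\Sigma)\to C^*(\Sigma')$ which maps $t^0(f)$ to $t'^0(f|_{X'})$ and $t^1(\xi)$ to $t'^1(\xi|_{X'\cap U})$. Then $I\mapsto X_I$ and $X'\mapsto I_{X'}$ are mutually inverse bijections between the set of gauge-invariant ideals of $C^*(\Sigma)$ and the set of closed $\sigma$-invariant subsets of $X$. -/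

import Mathlib

open Topology
open scoped CompactlySupported ZeroAtInfty ENNReal

universe u v w

/-- A singly generated dynamical system on `X`: a local homeomorphism `σ : U → X` defined on an
open subset `U` of `X`. -/
structure SGDS (X : Type u) [TopologicalSpace X] where
  /-- the domain of `σ` -/
  U : TopologicalSpace.Opens X
  /-- the local homeomorphism -/
  σ : U → X
  isLocalHomeomorph : IsLocalHomeomorph σ

namespace SGDS

section FiberSum

/-- Summing a compactly supported continuous function over the fibres of a local homeomorphism
gives a continuous function. -/
theorem continuous_fiberSum {Y : Type v} {X : Type u} [TopologicalSpace Y] [T2Space Y]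
    [TopologicalSpace X] [T2Space X] {s : Y → X} (hs : IsLocalHomeomorph s) (g : C_c(Y, ℂ)) :
    Continuous fun x : X => ∑ᶠ (y : Y) (_ : s y = x), g y := by
  classical
  rw [continuous_iff_continuousAt]
  intro x₀
  choose e he hes using hs
  have hsc : Continuous s := IsLocalHomeomorph.continuous fun y => ⟨e y, he y, hes y⟩
  have hK : IsCompact (tsupport g) := g.hasCompactSupport
  have hF : (tsupport g ∩ s ⁻¹' {x₀}).Finite := by
    have hFc : IsCompact (tsupport g ∩ s ⁻¹' {x₀}) :=
      hK.inter_right (isClosed_singleton.preimage hsc)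
    refine hFc.finite ?_
    rw [isDiscrete_iff_discreteTopology, discreteTopology_subtype_iff']
    rintro y ⟨hyK, hy⟩
    refine ⟨(e y).source, (e y).open_source, ?_⟩
    ext z
    constructor
    · rintro ⟨hz, -, hzx⟩
      refine (e y).injOn hz (he y) ?_
      rw [← hes y, show s z = x₀ from hzx, show s y = x₀ from hy]
    · rintro rfl
      exact ⟨he z, hyK, hy⟩
  obtain ⟨O, hO, hdisj⟩ := hF.t2_separation
  set F := hF.toFinset with hFdef
  have hmemF : ∀ y ∈ F, s y = x₀ := fun y hy => by
    have := (hF.mem_toFinset.1 hy).2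
    exact this
  set V : Y → Set Y := fun y => O y ∩ (e y).source with hV
  have hVo : ∀ y, IsOpen (V y) := fun y => (hO y).2.inter (e y).open_source
  have hsV : ∀ y, IsOpen (s '' V y) := by
    intro y
    have : s '' V y = e y '' V y := by rw [← hes y]
    rw [this]
    exact (e y).isOpen_image_of_subset_source (hVo y) Set.inter_subset_right
  set C : Set X := s '' (tsupport g \ ⋃ y ∈ F, V y) with hC
  have hCc : IsClosed C :=
    ((hK.diff (isOpen_biUnion fun y _ => hVo y)).image hsc).isClosed
  have hxC : x₀ ∉ C := by
    rintro ⟨y, ⟨hyK, hyV⟩, hyx⟩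
    apply hyV
    have hyF : y ∈ F := hF.mem_toFinset.2 ⟨hyK, hyx⟩
    exact Set.mem_biUnion hyF ⟨(hO y).1, he y⟩
  have hW : ∀ᶠ x in 𝓝 x₀, x ∉ C ∧ ∀ y ∈ F, x ∈ s '' V y := by
    refine Filter.Eventually.and (hCc.isOpen_compl.mem_nhds hxC) ?_
    rw [Filter.eventually_all_finset]
    intro y hy
    exact (hsV y).mem_nhds ⟨y, ⟨(hO y).1, he y⟩, hmemF y hy⟩
  have hsymm : ∀ y x, x ∈ s '' V y → (e y).symm x ∈ V y ∧ s ((e y).symm x) = x := by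
    rintro y x ⟨z, hz, rfl⟩
    have h1 : (e y).symm (s z) = z := by
      conv_lhs => rw [hes y]
      exact (e y).left_inv hz.2
    rw [h1]
    exact ⟨hz, rfl⟩
  have key : (fun x : X => ∑ᶠ (y : Y) (_ : s y = x), g y) =ᶠ[𝓝 x₀]
      fun x => ∑ y ∈ F, g ((e y).symm x) := by
    filter_upwards [hW] with x hx
    obtain ⟨hxC', hxV⟩ := hx
    have hinj : Set.InjOn (fun y => (e y).symm x) (F : Set Y) := by
      intro y hy y' hy' hyy
      by_contra hne
      have h1 := (hsymm y x (hxV y hy)).1.1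
      have h2 := (hsymm y' x (hxV y' hy')).1.1
      have hd := hdisj (by simpa [hFdef] using hy) (by simpa [hFdef] using hy') hne
      refine Set.disjoint_left.1 hd h1 ?_
      have h3 : (e y).symm x = (e y').symm x := hyy
      rw [h3]; exact h2
    rw [← Finset.sum_image (f := fun z => g z) hinj]
    refine finsum_mem_eq_sum_of_inter_support_eq (s := {y | s y = x}) _ ?_
    ext z
    constructor
    · rintro ⟨hz, hgz⟩
      refine ⟨?_, hgz⟩
      have hzK : z ∈ tsupport g := subset_tsupport _ hgz
      have hzV : z ∈ ⋃ y ∈ F, V y := by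
        by_contra h
        exact hxC' ⟨z, ⟨hzK, h⟩, hz⟩
      obtain ⟨y, hyF, hzy⟩ := Set.mem_iUnion₂.1 hzV
      refine Finset.mem_coe.2 (Finset.mem_image.2 ⟨y, hyF, ?_⟩)
      rw [← show s z = x from hz]
      conv_lhs => rw [hes y]
      exact (e y).left_inv hzy.2
    · rintro ⟨hz, hgz⟩
      refine ⟨?_, hgz⟩
      obtain ⟨y, hyF, rfl⟩ := Finset.mem_image.1 (Finset.mem_coe.1 hz)
      exact (hsymm y x (hxV y hyF)).2
  refine ContinuousAt.congr ?_ key.symm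
  refine tendsto_finsetSum _ fun y hy => ?_
  have hx₀ : x₀ ∈ (e y).target := by
    have h := (e y).map_source (he y)
    rwa [← hes y, hmemF y hy] at h
  exact (map_continuous g).continuousAt.comp ((e y).continuousAt_symm hx₀)

theorem hasCompactSupport_fiberSum {Y : Type v} {X : Type u} [TopologicalSpace Y]
    [TopologicalSpace X] [T2Space X] {s : Y → X} (hs : Continuous s) (g : C_c(Y, ℂ)) :
    HasCompactSupport fun x : X => ∑ᶠ (y : Y) (_ : s y = x), g y := by
  refine HasCompactSupport.intro (g.hasCompactSupport.isCompact.image hs) fun x hx => ?_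
  refine finsum_mem_eq_zero_of_forall_eq_zero fun y hy => ?_
  by_contra hg
  exact hx ⟨y, subset_tsupport _ hg, hy⟩

end FiberSum

noncomputable section

variable {X : Type u} [TopologicalSpace X] [T2Space X] (S : SGDS X)

/-- `⟨ξ, η⟩(x) = ∑_{σ(y) = x} conj (ξ y) * η y`, for `ξ, η ∈ C_c(U)`. The sum is finite, since `ξ` has
compact support and the fibres of `σ` are discrete; the result lies in `C_c(X) ⊆ C₀(X)`. -/
def ip (ξ η : C_c(S.U, ℂ)) : C₀(X, ℂ) where
  toFun x := ∑ᶠ (y : S.U) (_ : S.σ y = x), star (ξ y) * η y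
  continuous_toFun := continuous_fiberSum S.isLocalHomeomorph (star ξ * η)
  zero_at_infty' :=
    (hasCompactSupport_fiberSum S.isLocalHomeomorph.continuous (star ξ * η)).is_zero_at_infty

/-- The inclusion `C_c(U) ⊆ C₀(X)`, extending functions by zero. -/
def extend (ξ : C_c(S.U, ℂ)) : C₀(X, ℂ) where
  toFun := Function.extend Subtype.val ξ 0
  continuous_toFun :=
    HasCompactSupport.continuous_extend_zero S.U.isOpen (map_continuous ξ) ξ.hasCompactSupport
  zero_at_infty' :=
    (ξ.hasCompactSupport.extend_zero continuous_subtype_val).is_zero_at_infty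

/-- A representation of `S` in a C⋆-algebra `A`: a ⋆-homomorphism `t0 : C₀(X) → A` and a linear map
`t1 : C_c(U) → A` satisfying the two defining relations of `C⋆(S)`. In the second one, `ξ` and `η`
range over `C_c(V)`, regarded as the elements of `C_c(U)` whose support lies in `V`. -/
structure Rep (A : Type w) [NonUnitalCStarAlgebra A] where
  t0 : C₀(X, ℂ) →⋆ₙₐ[ℂ] A
  t1 : C_c(S.U, ℂ) →ₗ[ℂ] A
  star_t1_mul_t1 : ∀ ξ η : C_c(S.U, ℂ), star (t1 ξ) * t1 η = t0 (S.ip ξ η)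
  t1_mul_star_t1 : ∀ V : Set S.U, IsOpen V → Set.InjOn S.σ V →
    ∀ ξ η : C_c(S.U, ℂ), tsupport ξ ⊆ V → tsupport η ⊆ V →
      t1 ξ * star (t1 η) = t0 (S.extend (ξ * star η))


namespace Rep

variable {S} {A : Type w} [NonUnitalCStarAlgebra A]

/-- Composition of a representation with a ⋆-homomorphism. -/
def comp {B : Type v} [NonUnitalCStarAlgebra B] (φ : A →⋆ₙₐ[ℂ] B) (π : S.Rep A) : S.Rep B where
  t0 := φ.comp π.t0
  t1 := (φ : A →ₗ[ℂ] B).comp π.t1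
  star_t1_mul_t1 ξ η := by
    have h := congrArg φ (π.star_t1_mul_t1 ξ η)
    rwa [map_mul, map_star] at h
  t1_mul_star_t1 V hV hi ξ η hξ hη := by
    have h := congrArg φ (π.t1_mul_star_t1 V hV hi ξ η hξ hη)
    rwa [map_mul, map_star] at h

theorem norm_t0_le (π : S.Rep A) (f : C₀(X, ℂ)) : ‖π.t0 f‖ ≤ ‖f‖ := by
  let _ : NonUnitalCStarAlgebra C₀(X, ℂ) := {}
  exact NonUnitalStarAlgHom.norm_apply_le π.t0 f

theorem norm_t1_le (π : S.Rep A) (ξ : C_c(S.U, ℂ)) : ‖π.t1 ξ‖ ≤ √‖S.ip ξ ξ‖ := by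
  apply Real.le_sqrt_of_sq_le
  rw [sq, ← CStarRing.norm_star_mul_self, π.star_t1_mul_t1]
  exact π.norm_t0_le _

end Rep

/-- Formal ⋆-polynomials, without constant term, in generators indexed by `C₀(X)` and `C_c(U)`. -/
inductive StarPoly : Type u
  | t0 (f : C₀(X, ℂ)) : StarPoly
  | t1 (ξ : C_c(S.U, ℂ)) : StarPoly
  | add (a b : StarPoly) : StarPoly
  | mul (a b : StarPoly) : StarPoly
  | smul (c : ℂ) (a : StarPoly) : StarPoly
  | star (a : StarPoly) : StarPoly

variable {S} in
/-- The value of a ⋆-polynomial in a representation. -/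
def Rep.eval {A : Type w} [NonUnitalCStarAlgebra A] (π : S.Rep A) : S.StarPoly → A
  | .t0 f => π.t0 f
  | .t1 ξ => π.t1 ξ
  | .add a b => π.eval a + π.eval b
  | .mul a b => π.eval a * π.eval b
  | .smul c a => c • π.eval a
  | .star a => star (π.eval a)

/-- The C⋆-seminorms `a ↦ ‖π(a)‖` on ⋆-polynomials which come from representations `π` of `S` in
C⋆-algebras. They form a set, whereas the representations themselves do not. -/
def RepSeminorm : Type u :=
  {p : S.StarPoly → ℝ // ∃ (A : Type u) (_ : NonUnitalCStarAlgebra A) (π : S.Rep A),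
    ∀ a, p a = ‖π.eval a‖}

namespace RepSeminorm

variable {S}

/-- The target of a representation which induces the seminorm `p`. -/
def Alg (p : S.RepSeminorm) : Type u := p.2.choose

instance (p : S.RepSeminorm) : NonUnitalCStarAlgebra p.Alg := p.2.choose_spec.choose

/-- A representation which induces the seminorm `p`. -/
def rep (p : S.RepSeminorm) : S.Rep p.Alg := p.2.choose_spec.choose_spec.choose

theorem norm_eval (p : S.RepSeminorm) (a : S.StarPoly) : ‖p.rep.eval a‖ = p.1 a :=
  (p.2.choose_spec.choose_spec.choose_spec a).symm

end RepSeminorm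

/-- The `ℓ^∞` direct product of one representation of `S` for each of the seminorms above. -/
abbrev ProdAlg : Type u := lp (fun p : S.RepSeminorm => p.Alg) ∞

/-- The direct product of these representations. -/
def prodRep : S.Rep S.ProdAlg where
  t0 :=
    { toFun f := ⟨fun p => p.rep.t0 f, memℓp_infty ⟨‖f‖, by
        rintro _ ⟨p, rfl⟩; exact p.rep.norm_t0_le f⟩⟩
      map_smul' c f := by ext p; simp
      map_zero' := by ext p; simp
      map_add' f g := by ext p; exact map_add _ f g
      map_mul' f g := by ext p; simp
      map_star' f := by ext p; exact map_star p.rep.t0 f }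
  t1 :=
    { toFun ξ := ⟨fun p => p.rep.t1 ξ, memℓp_infty ⟨√‖S.ip ξ ξ‖, by
        rintro _ ⟨p, rfl⟩; exact p.rep.norm_t1_le ξ⟩⟩
      map_smul' c f := by ext p; simp
      map_add' f g := by ext p; exact map_add _ f g }
  star_t1_mul_t1 ξ η := by
    ext p
    simpa using p.rep.star_t1_mul_t1 ξ η
  t1_mul_star_t1 V hV hi ξ η hξ hη := by
    ext p
    simpa using p.rep.t1_mul_star_t1 V hV hi ξ η hξ hη

/-- The C⋆-subalgebra of `S.ProdAlg` generated by the images of `t0` and `t1`. -/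
def subalgebra : NonUnitalStarSubalgebra ℂ S.ProdAlg :=
  (NonUnitalStarAlgebra.adjoin ℂ
    (Set.range S.prodRep.t0 ∪ Set.range S.prodRep.t1)).topologicalClosure

/-- The universal C⋆-algebra `C⋆(S)` generated by the images of a ⋆-homomorphism
`t0 : C₀(X) → C⋆(S)` and a linear map `t1 : C_c(U) → C⋆(S)` satisfying the relations of `Rep`;
see `universal`, `adjoin_universal` and `lift` for its characterizing properties. -/
def CStar : Type u := S.subalgebra

instance : NonUnitalCStarAlgebra S.CStar :=
  NonUnitalStarSubalgebra.nonUnitalCStarAlgebra S.subalgebra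
    (h_closed := NonUnitalStarSubalgebra.isClosed_topologicalClosure _)

/-- The inclusion of `C⋆(S)` in the direct product. -/
def incl : S.CStar →⋆ₙₐ[ℂ] S.ProdAlg := NonUnitalStarSubalgebraClass.subtype S.subalgebra

theorem prodRep_t0_mem (f : C₀(X, ℂ)) : S.prodRep.t0 f ∈ S.subalgebra :=
  NonUnitalStarSubalgebra.le_topologicalClosure _
    (NonUnitalStarAlgebra.subset_adjoin ℂ _ (Or.inl ⟨f, rfl⟩))

theorem prodRep_t1_mem (ξ : C_c(S.U, ℂ)) : S.prodRep.t1 ξ ∈ S.subalgebra :=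
  NonUnitalStarSubalgebra.le_topologicalClosure _
    (NonUnitalStarAlgebra.subset_adjoin ℂ _ (Or.inr ⟨ξ, rfl⟩))

/-- The universal pair `(t0, t1)` for `C⋆(S)`. -/
def universal : S.Rep S.CStar where
  t0 := NonUnitalStarAlgHom.codRestrict S.prodRep.t0 S.subalgebra S.prodRep_t0_mem
  t1 :=
    { toFun ξ := ⟨S.prodRep.t1 ξ, S.prodRep_t1_mem ξ⟩
      map_smul' c ξ := Subtype.ext (map_smul S.prodRep.t1 c ξ)
      map_add' ξ η := Subtype.ext (map_add S.prodRep.t1 ξ η) }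
  star_t1_mul_t1 ξ η := Subtype.ext (S.prodRep.star_t1_mul_t1 ξ η)
  t1_mul_star_t1 V hV hi ξ η hξ hη := Subtype.ext (S.prodRep.t1_mul_star_t1 V hV hi ξ η hξ hη)

/-- `C⋆(S)` is generated, as a C⋆-algebra, by the images of `t0` and `t1`. -/
theorem adjoin_universal :
    (NonUnitalStarAlgebra.adjoin ℂ
      (Set.range S.universal.t0 ∪ Set.range S.universal.t1)).topologicalClosure = ⊤ := by
  set B := (NonUnitalStarAlgebra.adjoin ℂ
      (Set.range S.universal.t0 ∪ Set.range S.universal.t1)).topologicalClosure with hB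
  have hgen : Set.range S.universal.t0 ∪ Set.range S.universal.t1 ⊆ (B : Set S.CStar) :=
    (NonUnitalStarAlgebra.subset_adjoin ℂ _).trans
      (NonUnitalStarSubalgebra.le_topologicalClosure _)
  have hcl : IsClosed ((NonUnitalStarSubalgebra.map S.incl B : NonUnitalStarSubalgebra ℂ S.ProdAlg) :
      Set S.ProdAlg) := by
    rw [NonUnitalStarSubalgebra.coe_map]
    have hs : IsClosed (S.subalgebra : Set S.ProdAlg) :=
      NonUnitalStarSubalgebra.isClosed_topologicalClosure _
    have hBc : IsClosed (B : Set S.CStar) := by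
      rw [hB]
      exact NonUnitalStarSubalgebra.isClosed_topologicalClosure _
    exact hs.isClosedEmbedding_subtypeVal.isClosedMap (B : Set S.CStar) hBc
  have hle : S.subalgebra ≤ NonUnitalStarSubalgebra.map S.incl B := by
    refine NonUnitalStarSubalgebra.topologicalClosure_minimal _ ?_ hcl
    refine NonUnitalStarAlgebra.adjoin_le ?_
    rintro _ (⟨f, rfl⟩ | ⟨ξ, rfl⟩)
    · exact ⟨S.universal.t0 f, hgen (Or.inl ⟨f, rfl⟩), rfl⟩
    · exact ⟨S.universal.t1 ξ, hgen (Or.inr ⟨ξ, rfl⟩), rfl⟩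
  refine eq_top_iff.2 fun a _ => ?_
  obtain ⟨b, hb, hba⟩ := hle a.2
  rwa [← show b = a from Subtype.ext hba]

section Lift

variable {S} {A : Type u} [NonUnitalCStarAlgebra A] (π : S.Rep A)

/-- The graph of the ⋆-homomorphism `C⋆(S) → A` which is induced by a representation in `A`. -/
def graph : NonUnitalStarSubalgebra ℂ (S.CStar × A) :=
  (NonUnitalStarAlgebra.adjoin ℂ
    (Set.range (fun f => (S.universal.t0 f, π.t0 f)) ∪
      Set.range (fun ξ => (S.universal.t1 ξ, π.t1 ξ)))).topologicalClosure

instance : NonUnitalCStarAlgebra (graph π) :=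
  NonUnitalStarSubalgebra.nonUnitalCStarAlgebra (graph π)
    (h_closed := NonUnitalStarSubalgebra.isClosed_topologicalClosure _)

theorem prodRep_eval_apply (a : S.StarPoly) (p : S.RepSeminorm) :
    (S.prodRep.eval a) p = p.rep.eval a := by
  induction a with
  | t0 f => rfl
  | t1 ξ => rfl
  | add a b ha hb => simp only [Rep.eval, ← ha, ← hb]; rfl
  | mul a b ha hb => simp only [Rep.eval, ← ha, ← hb]; rfl
  | smul c a ha => simp only [Rep.eval, ← ha]; rfl
  | star a ha => simp only [Rep.eval, ← ha]; rfl

theorem incl_universal_eval (a : S.StarPoly) : S.incl (S.universal.eval a) = S.prodRep.eval a := by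
  induction a with
  | t0 f => rfl
  | t1 ξ => rfl
  | add a b ha hb => simp only [Rep.eval, map_add, ha, hb]
  | mul a b ha hb => simp only [Rep.eval, map_mul, ha, hb]
  | smul c a ha => simp only [Rep.eval, map_smul, ha]
  | star a ha => simp only [Rep.eval, map_star, ha]

theorem norm_eval_le (a : S.StarPoly) : ‖π.eval a‖ ≤ ‖S.universal.eval a‖ := by
  let p : S.RepSeminorm := ⟨fun a => ‖π.eval a‖, A, inferInstance, π, fun _ => rfl⟩
  calc ‖π.eval a‖ = ‖p.rep.eval a‖ := (p.norm_eval a).symm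
    _ = ‖(S.prodRep.eval a) p‖ := by rw [prodRep_eval_apply]
    _ ≤ ‖S.prodRep.eval a‖ := lp.norm_apply_le_norm ENNReal.top_ne_zero _ p
    _ = ‖S.incl (S.universal.eval a)‖ := by rw [incl_universal_eval]
    _ = ‖S.universal.eval a‖ := rfl

theorem graph_norm_le {x : S.CStar × A} (hx : x ∈ graph π) : ‖x.2‖ ≤ ‖x.1‖ := by
  have hcl : IsClosed {x : S.CStar × A | ‖x.2‖ ≤ ‖x.1‖} :=
    isClosed_le continuous_snd.norm continuous_fst.norm
  refine closure_minimal ?_ hcl hx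
  intro y hy
  suffices h : ∃ a : S.StarPoly, y = (S.universal.eval a, π.eval a) by
    obtain ⟨a, rfl⟩ := h
    exact norm_eval_le π a
  refine NonUnitalStarAlgebra.adjoin_induction (R := ℂ)
    (p := fun y _ => ∃ a : S.StarPoly, y = (S.universal.eval a, π.eval a)) ?_ ?_ ?_ ?_ ?_ ?_ hy
  · rintro _ (⟨f, rfl⟩ | ⟨ξ, rfl⟩)
    · exact ⟨.t0 f, rfl⟩
    · exact ⟨.t1 ξ, rfl⟩
  · rintro _ _ - - ⟨a, rfl⟩ ⟨b, rfl⟩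
    exact ⟨.add a b, rfl⟩
  · exact ⟨.t0 0, Prod.ext (by simp [Rep.eval]) (by simp [Rep.eval])⟩
  · rintro _ _ - - ⟨a, rfl⟩ ⟨b, rfl⟩
    exact ⟨.mul a b, rfl⟩
  · rintro c _ - ⟨a, rfl⟩
    exact ⟨.smul c a, rfl⟩
  · rintro _ - ⟨a, rfl⟩
    exact ⟨.star a, rfl⟩

/-- The first projection of the graph. -/
def graphFst : graph π →⋆ₙₐ[ℂ] S.CStar :=
  (NonUnitalStarAlgHom.fst ℂ S.CStar A).comp (NonUnitalStarSubalgebraClass.subtype (graph π))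

/-- The second projection of the graph. -/
def graphSnd : graph π →⋆ₙₐ[ℂ] A :=
  (NonUnitalStarAlgHom.snd ℂ S.CStar A).comp (NonUnitalStarSubalgebraClass.subtype (graph π))

theorem graph_t0_mem (f : C₀(X, ℂ)) : (S.universal.t0 f, π.t0 f) ∈ graph π :=
  NonUnitalStarSubalgebra.le_topologicalClosure _
    (NonUnitalStarAlgebra.subset_adjoin ℂ _ (Or.inl ⟨f, rfl⟩))

theorem graph_t1_mem (ξ : C_c(S.U, ℂ)) : (S.universal.t1 ξ, π.t1 ξ) ∈ graph π :=
  NonUnitalStarSubalgebra.le_topologicalClosure _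
    (NonUnitalStarAlgebra.subset_adjoin ℂ _ (Or.inr ⟨ξ, rfl⟩))

theorem graphFst_bijective : Function.Bijective (graphFst π) := by
  have hiso : Isometry (graphFst π) := by
    refine AddMonoidHomClass.isometry_of_norm _ fun x => ?_
    exact (max_eq_left (graph_norm_le π x.2)).symm
  refine ⟨hiso.injective, fun a => ?_⟩
  have hcl : IsClosed ((NonUnitalStarAlgHom.range (graphFst π) :
      NonUnitalStarSubalgebra ℂ S.CStar) : Set S.CStar) := by
    rw [NonUnitalStarAlgHom.coe_range]
    exact hiso.isClosedEmbedding.isClosed_range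
  have hle : (NonUnitalStarAlgebra.adjoin ℂ
      (Set.range S.universal.t0 ∪ Set.range S.universal.t1)).topologicalClosure ≤
      NonUnitalStarAlgHom.range (graphFst π) := by
    refine NonUnitalStarSubalgebra.topologicalClosure_minimal _
      (NonUnitalStarAlgebra.adjoin_le ?_) hcl
    rintro _ (⟨f, rfl⟩ | ⟨ξ, rfl⟩)
    · exact ⟨⟨_, graph_t0_mem π f⟩, rfl⟩
    · exact ⟨⟨_, graph_t1_mem π ξ⟩, rfl⟩
  rw [adjoin_universal] at hle
  exact hle (NonUnitalStarAlgebra.mem_top (x := a))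

/-- The universal property: a representation of `S` in `A` induces a ⋆-homomorphism
`C⋆(S) → A`. -/
def lift : S.CStar →⋆ₙₐ[ℂ] A :=
  (graphSnd π).comp
    ((StarAlgEquiv.ofBijective (graphFst π) (graphFst_bijective π)).symm :
      S.CStar →⋆ₙₐ[ℂ] graph π)

theorem lift_of_mem {x : S.CStar × A} (hx : x ∈ graph π) : lift π x.1 = x.2 := by
  have h : (StarAlgEquiv.ofBijective (graphFst π) (graphFst_bijective π)).symm x.1 = ⟨x, hx⟩ := by
    rw [StarAlgEquiv.symm_apply_eq]
    rfl
  exact congrArg (graphSnd π) h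

theorem lift_t0 (f : C₀(X, ℂ)) : lift π (S.universal.t0 f) = π.t0 f :=
  lift_of_mem π (graph_t0_mem π f)

theorem lift_t1 (ξ : C_c(S.U, ℂ)) : lift π (S.universal.t1 ξ) = π.t1 ξ :=
  lift_of_mem π (graph_t1_mem π ξ)

end Lift

/-- Multiplying `t1` by a complex number of modulus one gives a representation again. -/
def gaugeRep (z : Circle) : S.Rep S.CStar where
  t0 := S.universal.t0
  t1 := (z : ℂ) • S.universal.t1
  star_t1_mul_t1 ξ η := by
    have hz : star (z : ℂ) * z = 1 := by
      simp [← Complex.normSq_eq_conj_mul_self]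
    rw [LinearMap.smul_apply, LinearMap.smul_apply, star_smul, smul_mul_smul_comm, hz, one_smul,
      S.universal.star_t1_mul_t1]
  t1_mul_star_t1 V hV hi ξ η hξ hη := by
    have hz : (z : ℂ) * star (z : ℂ) = 1 := by
      simp [Complex.mul_conj]
    rw [LinearMap.smul_apply, LinearMap.smul_apply, star_smul, smul_mul_smul_comm, hz, one_smul,
      S.universal.t1_mul_star_t1 V hV hi ξ η hξ hη]

/-- The gauge action: `β_z(t0 f) = t0 f` and `β_z(t1 ξ) = z t1 ξ`. -/
def gauge (z : Circle) : S.CStar →⋆ₙₐ[ℂ] S.CStar := lift (S.gaugeRep z)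

/-- The set of gauge-invariant closed two-sided ideals of `C⋆(S)`. -/
def gaugeInvariantIdeals : Set (TwoSidedIdeal S.CStar) :=
  {I | IsClosed (I : Set S.CStar) ∧
    ∀ z : Circle, S.gauge z '' (I : Set S.CStar) = (I : Set S.CStar)}

/-- A closed `σ`-invariant subset of `X`. -/
structure ClosedInvariant {X : Type u} [TopologicalSpace X] (S : SGDS X) where
  carrier : Set X
  isClosed : IsClosed carrier
  invariant : ∀ x : S.U, (x : X) ∈ carrier ↔ S.σ x ∈ carrier

section Restrict

variable {S} (Y : ClosedInvariant S)

/-- `U' = X' ∩ U`, as an open subset of `X'`. -/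
def restrictU : TopologicalSpace.Opens Y.carrier :=
  TopologicalSpace.Opens.comap ⟨Subtype.val, continuous_subtype_val⟩ S.U

/-- The inclusion `U' → U`. -/
def restrictIncl (y : restrictU Y) : S.U := ⟨y.1.1, y.2⟩

/-- The restriction `σ' : U' → X'` of `σ`. -/
def restrictσ (y : restrictU Y) : Y.carrier :=
  ⟨S.σ (restrictIncl Y y), (Y.invariant (restrictIncl Y y)).1 y.1.2⟩

theorem restrictIncl_isClosedEmbedding : IsClosedEmbedding (restrictIncl Y) := by
  have hemb : IsEmbedding (restrictIncl Y) := by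
    refine IsEmbedding.of_comp (g := (Subtype.val : S.U → X)) ?_ continuous_subtype_val ?_
    · exact Continuous.subtype_mk (continuous_subtype_val.comp continuous_subtype_val) _
    · have h : IsEmbedding fun y : restrictU Y => (y.1 : X) :=
        IsEmbedding.subtypeVal.comp IsEmbedding.subtypeVal
      exact h
  refine ⟨hemb, ?_⟩
  have : Set.range (restrictIncl Y) = Subtype.val ⁻¹' Y.carrier := by
    ext x
    exact ⟨by rintro ⟨y, rfl⟩; exact y.1.2, fun h => ⟨⟨⟨x.1, h⟩, x.2⟩, rfl⟩⟩
  rw [this]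
  exact Y.isClosed.preimage continuous_subtype_val

theorem restrictσ_isLocalHomeomorph : IsLocalHomeomorph (restrictσ Y) := by
  have hemb := (restrictIncl_isClosedEmbedding Y).isEmbedding
  have hcont : Continuous (restrictσ Y) :=
    (S.isLocalHomeomorph.continuous.comp hemb.continuous).subtype_mk _
  have hopen : IsOpenMap (restrictσ Y) := by
    intro O hO
    obtain ⟨O', hO', rfl⟩ := hemb.isOpen_iff.1 hO
    refine isOpen_induced_iff.2 ⟨S.σ '' O', S.isLocalHomeomorph.isOpenMap O' hO', ?_⟩
    ext x
    constructor
    · rintro ⟨y, hy, hyx⟩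
      have hyY : (y : X) ∈ Y.carrier := (Y.invariant y).2 (by rw [hyx]; exact x.2)
      exact ⟨⟨⟨y.1, hyY⟩, y.2⟩, hy, Subtype.ext hyx⟩
    · rintro ⟨y, hy, rfl⟩
      exact ⟨restrictIncl Y y, hy, rfl⟩
  rw [isLocalHomeomorph_iff_isOpenEmbedding_restrict]
  intro y
  obtain ⟨e, hy, he⟩ := S.isLocalHomeomorph (restrictIncl Y y)
  have hN : IsOpen (restrictIncl Y ⁻¹' e.source) := e.open_source.preimage hemb.continuous
  refine ⟨_, hN.mem_nhds hy, ?_⟩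
  refine IsOpenEmbedding.of_continuous_injective_isOpenMap
    (hcont.comp continuous_subtype_val) ?_ (hopen.comp hN.isOpenMap_subtype_val)
  intro a b hab
  have h1 : S.σ (restrictIncl Y a) = S.σ (restrictIncl Y b) := congrArg Subtype.val hab
  rw [he] at h1
  exact Subtype.ext (hemb.injective (e.injOn a.2 b.2 h1))

/-- The restriction of `S` to a closed `σ`-invariant subset. -/
def restrict : SGDS Y.carrier where
  U := restrictU Y
  σ := restrictσ Y
  isLocalHomeomorph := restrictσ_isLocalHomeomorph Y

/-- The inclusion `X' → X` as a cocompact map. -/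
def cocompactX : CocompactMap Y.carrier X where
  toFun := Subtype.val
  continuous_toFun := continuous_subtype_val
  cocompact_tendsto' := Y.isClosed.isClosedEmbedding_subtypeVal.tendsto_cocompact

/-- The inclusion `U' → U` as a cocompact map. -/
def cocompactU : CocompactMap (restrict Y).U S.U where
  toFun := restrictIncl Y
  continuous_toFun := (restrictIncl_isClosedEmbedding Y).continuous
  cocompact_tendsto' := (restrictIncl_isClosedEmbedding Y).tendsto_cocompact

/-- The restriction map `f ↦ f|_{X'}` from `C₀(X)` to `C₀(X')`. -/
def resC0 (f : C₀(X, ℂ)) : C₀(Y.carrier, ℂ) := f.comp (cocompactX Y)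

/-- The restriction map `ξ ↦ ξ|_{U'}` from `C_c(U)` to `C_c(U')`. -/
def resCc (ξ : C_c(S.U, ℂ)) : C_c((restrict Y).U, ℂ) := ξ.comp (cocompactU Y)

theorem resC0_ip (ξ η : C_c(S.U, ℂ)) :
    resC0 Y (S.ip ξ η) = (restrict Y).ip (resCc Y ξ) (resCc Y η) := by
  ext x
  symm
  refine finsum_mem_eq_of_bijOn (s := {y | restrictσ Y y = x}) (t := {y | S.σ y = x.1})
    (restrictIncl Y) ⟨?_, ?_, ?_⟩ ?_
  · rintro y rfl
    rfl
  · exact (restrictIncl_isClosedEmbedding Y).injective.injOn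
  · intro y hy
    have hyY : (y : X) ∈ Y.carrier := (Y.invariant y).2 (by rw [show S.σ y = x.1 from hy]; exact x.2)
    exact ⟨⟨⟨y.1, hyY⟩, y.2⟩, Subtype.ext hy, rfl⟩
  · intro y _
    rfl

theorem extend_apply (S : SGDS X) (ξ : C_c(S.U, ℂ)) (x : S.U) : S.extend ξ x = ξ x :=
  Subtype.val_injective.extend_apply _ _ _

theorem extend_apply_of_notMem (S : SGDS X) (ξ : C_c(S.U, ℂ)) {x : X} (hx : x ∉ S.U) :
    S.extend ξ x = 0 :=
  Function.extend_apply' _ _ _ (by rintro ⟨y, rfl⟩; exact hx y.2)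

theorem resC0_extend (ξ : C_c(S.U, ℂ)) :
    resC0 Y (S.extend ξ) = (restrict Y).extend (resCc Y ξ) := by
  ext x
  by_cases hx : (x : X) ∈ S.U
  · exact (extend_apply S ξ ⟨x, hx⟩).trans (extend_apply (restrict Y) (resCc Y ξ) ⟨x, hx⟩).symm
  · exact (extend_apply_of_notMem S ξ hx).trans
      (extend_apply_of_notMem (restrict Y) (resCc Y ξ) hx).symm

theorem tsupport_resCc_subset (ξ : C_c(S.U, ℂ)) :
    tsupport (resCc Y ξ) ⊆ restrictIncl Y ⁻¹' tsupport ξ :=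
  closure_minimal (fun _ hy => subset_tsupport _ hy)
    ((isClosed_tsupport _).preimage (restrictIncl_isClosedEmbedding Y).continuous)

/-- The representation `f ↦ t'0(f|_{X'})`, `ξ ↦ t'1(ξ|_{U'})` of `S` in the C⋆-algebra of the
restriction of `S` to `X'`. -/
def restrictRep : S.Rep (restrict Y).CStar where
  t0 :=
    { toFun f := (restrict Y).universal.t0 (resC0 Y f)
      map_smul' c f := map_smul (restrict Y).universal.t0 c (resC0 Y f)
      map_zero' := map_zero (restrict Y).universal.t0
      map_add' f g := map_add (restrict Y).universal.t0 (resC0 Y f) (resC0 Y g)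
      map_mul' f g := map_mul (restrict Y).universal.t0 (resC0 Y f) (resC0 Y g)
      map_star' f := map_star (restrict Y).universal.t0 (resC0 Y f) }
  t1 :=
    { toFun ξ := (restrict Y).universal.t1 (resCc Y ξ)
      map_smul' c ξ := map_smul (restrict Y).universal.t1 c (resCc Y ξ)
      map_add' ξ η := map_add (restrict Y).universal.t1 (resCc Y ξ) (resCc Y η) }
  star_t1_mul_t1 ξ η := by
    refine ((restrict Y).universal.star_t1_mul_t1 (resCc Y ξ) (resCc Y η)).trans ?_
    rw [← resC0_ip]
    rfl
  t1_mul_star_t1 V hV hi ξ η hξ hη := by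
    refine ((restrict Y).universal.t1_mul_star_t1 (restrictIncl Y ⁻¹' V)
      (hV.preimage (restrictIncl_isClosedEmbedding Y).continuous) ?_ (resCc Y ξ) (resCc Y η)
      ((tsupport_resCc_subset Y ξ).trans (Set.preimage_mono hξ))
      ((tsupport_resCc_subset Y η).trans (Set.preimage_mono hη))).trans ?_
    · intro a ha b hb hab
      exact (restrictIncl_isClosedEmbedding Y).injective
        (hi ha hb (congrArg Subtype.val hab))
    · exact congrArg (restrict Y).universal.t0 (resC0_extend Y (ξ * star η)).symm

/-- The restriction map `Φ : C⋆(S) → C⋆(S')`, where `S'` is the restriction of `S` to `X'`. -/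
def restrictHom : S.CStar →⋆ₙₐ[ℂ] (restrict Y).CStar := lift (restrictRep Y)

theorem restrictHom_t0 (f : C₀(X, ℂ)) :
    restrictHom Y (S.universal.t0 f) = (restrict Y).universal.t0 (resC0 Y f) :=
  lift_t0 (restrictRep Y) f

theorem restrictHom_t1 (ξ : C_c(S.U, ℂ)) :
    restrictHom Y (S.universal.t1 ξ) = (restrict Y).universal.t1 (resCc Y ξ) :=
  lift_t1 (restrictRep Y) ξ

/-- The ideal `I_{X'}`: the kernel of the restriction map. -/
def idealOf : TwoSidedIdeal S.CStar := TwoSidedIdeal.ker (restrictHom Y)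

end Restrict

/-- The relation `C = X_I`, for closed `C`: we have `t0(C₀(X ∖ C)) = t0(C₀(X)) ∩ I`. Here `C₀(X ∖ C)` is
regarded as the set of all elements of `C₀(X)` which vanish on `C`. -/
def IsSetOf (I : TwoSidedIdeal S.CStar) (C : Set X) : Prop :=
  S.universal.t0 '' {f : C₀(X, ℂ) | ∀ x ∈ C, f x = 0} =
    Set.range S.universal.t0 ∩ (I : Set S.CStar)

end

end SGDS

/-! The heart of the matter is that a gauge-invariant closed ideal is determined by its intersection
with `t0(C₀(X))` (`le_of_gauge_invariant`).

Let `I` be closed and gauge-invariant, `I'` closed, and suppose `t0 f ∈ I` implies `t0 f ∈ I'`. For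
`a ∈ I` the spectral components `aₙ = ∫ z⁻ⁿ β_z(a) dz` lie in `I` by invariance. It is enough that
they lie in `I'`, because then the orbit of `a` has zero Fourier series modulo `I'`
(`mem_of_forall_component_mem`). By the C⋆-identity in the quotient by `I'` it is even enough to
treat `aₙ* aₙ`. This element is fixed by the gauge action, so it lies in the closure of the core,
the ⋆-algebra spanned by the products `t1 ξ₁ ⋯ t1 ξₙ · t0 f · (t1 ηₙ)* ⋯ (t1 η₁)*`
(`component_zero_mem`).

Inside the core, bound the number of factors and confine all supports to one compact set. Every
point of `X` then has a neighbourhood `V` such that compression by functions supported in `V`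
carries this whole stage of the core into `t0(C₀(X))` (`Core.exists_open_mem_range`): near the
point, the outer factors can be replaced by ones supported where `σ` is injective, and relation (ii)
removes them one layer at a time. So if `b ∈ I` belongs to the closure of the stage and `k` is
supported in `V`, then `k̄ b* b k` is in `t0(C₀(X)) ∩ I`, hence in `I'`, and so `b k ∈ I'`. As such
`k` have no common zero, `b ∈ I'` (`mem_of_mem_closure_coreAlg`). Comparing norms in the two
quotients extends this to the closure of the core (`mem_of_mem_closure_isCore`).

On the side of sets, `t0` is injective because `C⋆(S)` acts on `ℓ²(X)`, and closed ideals of `C₀(X)`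
correspond to closed sets. Conjugation by `t1 ξ`, in either order, shows that `X_I` is invariant
(`mem_zeroSet_iff`). For a closed invariant `Y` the restriction map intertwines the gauge actions
and `t0` of the restricted system is injective, so `I_Y` is gauge-invariant with set `Y`
(`isSetOf_idealOf`). -/

section CStarIdeals

/-! ### Closed ideals and quotients of C⋆-algebras -/

variable {A : Type u} [NonUnitalCStarAlgebra A]

/-- Elements of the form `star a * a * w` act as approximate right units for `a`. -/
theorem CStarAlgebra.exists_approx_right_unit (a : A) {ε : ℝ} (hε : 0 < ε) :
    ∃ w : A, ‖a - a * (star a * a * w)‖ ≤ ε ∧ ∀ x : A, ‖x - x * (star a * a * w)‖ ≤ ‖x‖ := by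
  have hδ : ∀ t : ℝ, t ^ 2 + ε ^ 4 ≠ 0 := fun t => by positivity
  set c : A := star a * a with hc
  have hcs : IsSelfAdjoint c := IsSelfAdjoint.star_mul_self a
  -- With `w = f(c)`, the defect `v = 1 - c w` is `ε⁴ / (c² + ε⁴)`, a contraction, and `‖a v‖² = ‖v
  -- c v‖`. The constant `ε⁴` is chosen so that `|t| ε² ≤ t² + ε⁴` bounds this by `ε²`. The
  -- computation takes place in the unitization, where `1` is available.
  set f : ℝ → ℝ := fun t => t / (t ^ 2 + ε ^ 4) with hf
  have hfc : Continuous f := by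
    refine continuous_id.div (by fun_prop) hδ
  have hf0 : f 0 = 0 := by simp [hf]
  have hu : c * cfcₙ f c = cfcₙ (fun t => t * f t) c := by
    rw [cfcₙ_mul (fun t : ℝ => t) f c (by fun_prop) rfl hfc.continuousOn hf0, cfcₙ_id' ℝ c hcs]
  set v : Unitization ℂ A := 1 - ((c * cfcₙ f c : A) : Unitization ℂ A) with hv
  have hcs' : IsSelfAdjoint (c : Unitization ℂ A) := by
    rw [IsSelfAdjoint, ← Unitization.inr_star, hcs.star_eq]
  have hvc : v = cfc (fun t => 1 - t * f t) (c : Unitization ℂ A) := by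
    rw [hv, hu, Unitization.real_cfcₙ_eq_cfc_inr c _ (by simp),
      cfc_sub (fun _ => (1 : ℝ)) (fun t => t * f t) _ (by fun_prop) (by fun_prop),
      cfc_const_one ℝ (c : Unitization ℂ A) hcs']
  have hval : ∀ t : ℝ, 1 - t * f t = ε ^ 4 / (t ^ 2 + ε ^ 4) := fun t => by
    have := hδ t
    simp only [hf]; field_simp; ring
  have hvn : ‖v‖ ≤ 1 := by
    rw [hvc]
    refine norm_cfc_le zero_le_one fun t _ => ?_
    rw [hval, Real.norm_of_nonneg (by positivity)]
    exact div_le_one_of_le₀ (by nlinarith [sq_nonneg t]) (by positivity)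
  have hvs : IsSelfAdjoint v := by rw [hvc]; exact cfc_predicate _ _
  have key : ∀ x : A, ‖x - x * (c * cfcₙ f c)‖ = ‖(x : Unitization ℂ A) * v‖ := fun x => by
    rw [← Unitization.norm_inr (𝕜 := ℂ), Unitization.inr_sub, Unitization.inr_mul, hv, mul_sub,
      mul_one]
  refine ⟨cfcₙ f c, ?_, fun x => ?_⟩
  · refine le_of_sq_le_sq ?_ hε.le
    rw [key, sq, ← CStarRing.norm_star_mul_self, star_mul, hvs.star_eq]
    have h1 : v * star (a : Unitization ℂ A) * ((a : Unitization ℂ A) * v) =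
        cfc (fun t => (1 - t * f t) * (t * (1 - t * f t))) (c : Unitization ℂ A) := by
      rw [cfc_mul (fun t => 1 - t * f t) (fun t => t * (1 - t * f t)) _ (by fun_prop)
        (by fun_prop), cfc_mul (fun t => t) (fun t => 1 - t * f t) _ (by fun_prop) (by fun_prop),
        cfc_id' ℝ _ hcs', ← hvc, hc, Unitization.inr_mul, Unitization.inr_star]
      simp only [mul_assoc]
    rw [h1]
    refine norm_cfc_le (by positivity) fun t _ => ?_
    rw [hval, norm_mul, norm_mul, Real.norm_of_nonneg (r := ε ^ 4 / _) (by positivity)]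
    have h2 : ε ^ 4 / (t ^ 2 + ε ^ 4) ≤ 1 :=
      div_le_one_of_le₀ (by nlinarith [sq_nonneg t]) (by positivity)
    have h3 : ‖t‖ * (ε ^ 4 / (t ^ 2 + ε ^ 4)) ≤ ε ^ 2 := by
      rw [← mul_div_assoc, div_le_iff₀ (by positivity), Real.norm_eq_abs]
      have h5 : |t| * ε ^ 2 ≤ t ^ 2 + ε ^ 4 := by
        nlinarith [sq_nonneg (|t| - ε ^ 2), sq_abs t, mul_nonneg (abs_nonneg t) (sq_nonneg ε)]
      nlinarith [sq_nonneg ε]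
    calc _ ≤ 1 * ε ^ 2 := mul_le_mul h2 h3 (by positivity) zero_le_one
      _ = ε ^ 2 := one_mul _
  · rw [key]
    calc _ ≤ ‖(x : Unitization ℂ A)‖ * ‖v‖ := norm_mul_le _ _
      _ ≤ ‖(x : Unitization ℂ A)‖ * 1 := by gcongr
      _ = ‖x‖ := by rw [mul_one, Unitization.norm_inr]

namespace TwoSidedIdeal

variable (I : TwoSidedIdeal A)

theorem mem_of_forall_norm_sub_le (hI : IsClosed (I : Set A)) {a : A}
    (h : ∀ ε > 0, ∃ b ∈ I, ‖a - b‖ ≤ ε) : a ∈ I := by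
  refine hI.closure_subset (Metric.mem_closure_iff.2 fun ε hε => ?_)
  obtain ⟨b, hb, hab⟩ := h (ε / 2) (half_pos hε)
  exact ⟨b, hb, by rw [dist_eq_norm]; linarith⟩

/-- The approximation `star a * (a * star a * w)` of `star a` has `a` as a factor, so it is in `I`.
-/
theorem star_mem_of_isClosed (hI : IsClosed (I : Set A)) {a : A} (ha : a ∈ I) : star a ∈ I := by
  refine I.mem_of_forall_norm_sub_le hI fun ε hε => ?_
  obtain ⟨w, hw, -⟩ := CStarAlgebra.exists_approx_right_unit (star a) hε
  refine ⟨_, I.mul_mem_left _ _ (I.mul_mem_right _ _ (I.mul_mem_right _ _ ?_)), hw⟩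
  rwa [star_star]

/-- A `TwoSidedIdeal` is only a ring ideal. With an approximate unit the scalar can be moved to the
other factor of a product. -/
theorem smul_mem_of_isClosed (hI : IsClosed (I : Set A)) (c : ℂ) {a : A} (ha : a ∈ I) :
    c • a ∈ I := by
  refine I.mem_of_forall_norm_sub_le hI fun ε hε => ?_
  obtain ⟨w, hw, -⟩ := CStarAlgebra.exists_approx_right_unit (c • a) hε
  refine ⟨_, ?_, hw⟩
  rw [smul_mul_assoc, ← mul_smul_comm]
  exact I.mul_mem_right _ _ ha

/-- A closed two-sided ideal of a C⋆-algebra, as a subspace. -/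
def closedSubmodule (hI : IsClosed (I : Set A)) : Submodule ℂ A where
  carrier := I
  add_mem' := I.add_mem
  zero_mem' := I.zero_mem
  smul_mem' c _ h := I.smul_mem_of_isClosed hI c h

/-- The quotient of a C⋆-algebra by a closed two-sided ideal. -/
def CStarQuotient (hI : IsClosed (I : Set A)) : Type u := A ⧸ I.closedSubmodule hI

namespace CStarQuotient

variable {I} (hI : IsClosed (I : Set A))

noncomputable instance : NormedAddCommGroup (I.CStarQuotient hI) :=
  Submodule.Quotient.normedAddCommGroup (I.closedSubmodule hI) (hS := hI)

noncomputable instance : NormedSpace ℂ (I.CStarQuotient hI) :=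
  inferInstanceAs (NormedSpace ℂ (A ⧸ I.closedSubmodule hI))

instance : CompleteSpace (I.CStarQuotient hI) :=
  inferInstanceAs (CompleteSpace (A ⧸ I.closedSubmodule hI))

/-- The quotient map, as a linear map. -/
noncomputable def mkₗ : A →ₗ[ℂ] I.CStarQuotient hI := (I.closedSubmodule hI).mkQ

theorem mkₗ_surjective : Function.Surjective (mkₗ hI) := Submodule.mkQ_surjective _

theorem mkₗ_eq_iff {a b : A} : mkₗ hI a = mkₗ hI b ↔ a - b ∈ I :=
  Submodule.Quotient.eq (I.closedSubmodule hI)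

theorem norm_mkₗ_le (a : A) : ‖mkₗ hI a‖ ≤ ‖a‖ :=
  Submodule.Quotient.norm_mk_le (I.closedSubmodule hI) a

theorem exists_norm_lt (x : I.CStarQuotient hI) {ε : ℝ} (hε : 0 < ε) :
    ∃ a, mkₗ hI a = x ∧ ‖a‖ < ‖x‖ + ε :=
  Submodule.Quotient.norm_mk_lt x hε

noncomputable instance : Mul (I.CStarQuotient hI) where
  mul := Quotient.map₂ (· * ·) fun a a' ha b b' hb => by
    have ha' : a - a' ∈ I := (Submodule.quotientRel_def (I.closedSubmodule hI)).1 ha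
    have hb' : b - b' ∈ I := (Submodule.quotientRel_def (I.closedSubmodule hI)).1 hb
    refine (Submodule.quotientRel_def (I.closedSubmodule hI)).2 ?_
    change a * b - a' * b' ∈ I
    have : a * b - a' * b' = (a - a') * b + a' * (b - b') := by noncomm_ring
    rw [this]
    exact I.add_mem (I.mul_mem_right _ _ ha') (I.mul_mem_left _ _ hb')

noncomputable instance : Star (I.CStarQuotient hI) where
  star := Quotient.map star fun a a' ha => by
    have ha' : a - a' ∈ I := (Submodule.quotientRel_def (I.closedSubmodule hI)).1 ha
    refine (Submodule.quotientRel_def (I.closedSubmodule hI)).2 ?_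
    change star a - star a' ∈ I
    rw [← star_sub]
    exact I.star_mem_of_isClosed hI ha'

theorem mkₗ_mul (a b : A) : mkₗ hI (a * b) = mkₗ hI a * mkₗ hI b := rfl

theorem mkₗ_star (a : A) : mkₗ hI (star a) = star (mkₗ hI a) := rfl

theorem norm_mul_le' (x y : I.CStarQuotient hI) : ‖x * y‖ ≤ ‖x‖ * ‖y‖ := by
  have hlim : Filter.Tendsto (fun ε : ℝ => (‖x‖ + ε) * (‖y‖ + ε)) (𝓝[>] 0) (𝓝 (‖x‖ * ‖y‖)) := by
    have h : Continuous fun ε : ℝ => (‖x‖ + ε) * (‖y‖ + ε) := by fun_prop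
    simpa using (h.tendsto 0).mono_left nhdsWithin_le_nhds
  refine ge_of_tendsto hlim ?_
  filter_upwards [self_mem_nhdsWithin] with ε hε
  obtain ⟨a, rfl, ha⟩ := exists_norm_lt hI x hε
  obtain ⟨b, rfl, hb⟩ := exists_norm_lt hI y hε
  rw [← mkₗ_mul]
  exact (norm_mkₗ_le hI _).trans ((norm_mul_le _ _).trans
    (mul_le_mul ha.le hb.le (norm_nonneg _) ((norm_nonneg _).trans ha.le)))

/-- Represent `x` by `a` and `x* x` by a nearly norm-minimal `b`, so that `a* a - b ∈ I`. If `z ∈ I`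
is an approximate unit for this difference, `a(1 - z)` still represents `x`, and `‖(1 - z*) a* a (1
- z)‖` is at most `‖b‖` up to a small error. -/
theorem norm_mul_self_le' (x : I.CStarQuotient hI) : ‖x‖ * ‖x‖ ≤ ‖star x * x‖ := by
  refine le_of_forall_pos_le_add fun ε hε => ?_
  obtain ⟨a, rfl⟩ := mkₗ_surjective hI x
  obtain ⟨b, hb, hbn⟩ := exists_norm_lt hI (star (mkₗ hI a) * mkₗ hI a) (half_pos hε)
  have hi : star a * a - b ∈ I := (mkₗ_eq_iff hI).1 hb.symm
  obtain ⟨w, hw, hw'⟩ := CStarAlgebra.exists_approx_right_unit (star a * a - b) (half_pos hε)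
  -- The contraction estimate for `1 - z` serves twice: for `b(1 - z)` and, after taking adjoints,
  -- for left multiplication by `1 - z*`.
  set z := star (star a * a - b) * (star a * a - b) * w with hz
  have hzI : z ∈ I := I.mul_mem_right _ _ (I.mul_mem_left _ _ hi)
  have h1 : mkₗ hI a = mkₗ hI (a - a * z) := by
    rw [mkₗ_eq_iff, sub_sub_cancel]
    exact I.mul_mem_left _ _ hzI
  have hstar : ∀ y : A, ‖y - star z * y‖ ≤ ‖y‖ := fun y => by
    have := hw' (star y)
    rwa [← norm_star, star_sub, star_mul, star_star, norm_star] at this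
  have h2 : star (a - a * z) * (a - a * z) =
      (star a * a - star a * a * z) - star z * (star a * a - star a * a * z) := by
    simp only [star_sub, star_mul]; noncomm_ring
  have h3 : star a * a - star a * a * z =
      (b - b * z) + ((star a * a - b) - (star a * a - b) * z) := by noncomm_ring
  calc ‖mkₗ hI a‖ * ‖mkₗ hI a‖ ≤ ‖a - a * z‖ * ‖a - a * z‖ := by
        rw [h1]; gcongr <;> exact norm_mkₗ_le hI _
    _ = ‖star (a - a * z) * (a - a * z)‖ := CStarRing.norm_star_mul_self.symm
    _ ≤ ‖star a * a - star a * a * z‖ := by rw [h2]; exact hstar _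
    _ ≤ ‖b - b * z‖ + ‖(star a * a - b) - (star a * a - b) * z‖ := by
        rw [h3]; exact norm_add_le _ _
    _ ≤ ‖b‖ + ε / 2 := add_le_add (hw' b) hw
    _ ≤ _ := by linarith

noncomputable instance : NonUnitalNormedRing (I.CStarQuotient hI) where
  __ := (inferInstance : NormedAddCommGroup (I.CStarQuotient hI))
  left_distrib x y z := by
    obtain ⟨x, rfl⟩ := mkₗ_surjective hI x
    obtain ⟨y, rfl⟩ := mkₗ_surjective hI y
    obtain ⟨z, rfl⟩ := mkₗ_surjective hI z
    exact congrArg (mkₗ hI) (mul_add x y z)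
  right_distrib x y z := by
    obtain ⟨x, rfl⟩ := mkₗ_surjective hI x
    obtain ⟨y, rfl⟩ := mkₗ_surjective hI y
    obtain ⟨z, rfl⟩ := mkₗ_surjective hI z
    exact congrArg (mkₗ hI) (add_mul x y z)
  zero_mul x := by
    obtain ⟨x, rfl⟩ := mkₗ_surjective hI x
    exact congrArg (mkₗ hI) (zero_mul x)
  mul_zero x := by
    obtain ⟨x, rfl⟩ := mkₗ_surjective hI x
    exact congrArg (mkₗ hI) (mul_zero x)
  mul_assoc x y z := by
    obtain ⟨x, rfl⟩ := mkₗ_surjective hI x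
    obtain ⟨y, rfl⟩ := mkₗ_surjective hI y
    obtain ⟨z, rfl⟩ := mkₗ_surjective hI z
    exact congrArg (mkₗ hI) (mul_assoc x y z)
  norm_mul_le := norm_mul_le' hI

noncomputable instance : StarRing (I.CStarQuotient hI) where
  star_involutive x := by
    obtain ⟨x, rfl⟩ := mkₗ_surjective hI x
    exact congrArg (mkₗ hI) (star_star x)
  star_mul x y := by
    obtain ⟨x, rfl⟩ := mkₗ_surjective hI x
    obtain ⟨y, rfl⟩ := mkₗ_surjective hI y
    exact congrArg (mkₗ hI) (star_mul x y)
  star_add x y := by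
    obtain ⟨x, rfl⟩ := mkₗ_surjective hI x
    obtain ⟨y, rfl⟩ := mkₗ_surjective hI y
    exact congrArg (mkₗ hI) (star_add x y)

noncomputable instance : NonUnitalCStarAlgebra (I.CStarQuotient hI) where
  norm_mul_self_le := norm_mul_self_le' hI
  norm_smul_le := norm_smul_le
  smul_assoc c x y := by
    obtain ⟨x, rfl⟩ := mkₗ_surjective hI x
    obtain ⟨y, rfl⟩ := mkₗ_surjective hI y
    exact congrArg (mkₗ hI) (smul_mul_assoc c x y)
  smul_comm c x y := by
    obtain ⟨x, rfl⟩ := mkₗ_surjective hI x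
    obtain ⟨y, rfl⟩ := mkₗ_surjective hI y
    exact congrArg (mkₗ hI) (mul_smul_comm c x y).symm
  star_smul c x := by
    obtain ⟨x, rfl⟩ := mkₗ_surjective hI x
    exact congrArg (mkₗ hI) (star_smul c x)

/-- The quotient map, as a ⋆-homomorphism. -/
noncomputable def mk : A →⋆ₙₐ[ℂ] I.CStarQuotient hI where
  toFun := mkₗ hI
  map_smul' := map_smul (mkₗ hI)
  map_zero' := map_zero (mkₗ hI)
  map_add' := map_add (mkₗ hI)
  map_mul' := mkₗ_mul hI
  map_star' := mkₗ_star hI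

theorem mk_eq_zero {a : A} : mk hI a = 0 ↔ a ∈ I := by
  have h := mkₗ_eq_iff hI (a := a) (b := 0)
  rwa [sub_zero, map_zero] at h

end CStarQuotient

/-- This is the C⋆-identity in the quotient. -/
theorem mem_of_star_mul_self_mem (hI : IsClosed (I : Set A)) {a : A} (h : star a * a ∈ I) :
    a ∈ I := by
  rw [← CStarQuotient.mk_eq_zero hI] at *
  rwa [map_mul, map_star, CStarRing.star_mul_self_eq_zero_iff] at h

end TwoSidedIdeal

theorem NonUnitalStarAlgHom.continuous' {B : Type v} [NonUnitalCStarAlgebra B]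
    (φ : A →⋆ₙₐ[ℂ] B) : Continuous φ :=
  AddMonoidHomClass.continuous_of_bound φ 1 fun a => by
    simpa using NonUnitalStarAlgHom.norm_apply_le φ a

/-- If the kernel of one ⋆-homomorphism is contained in that of another, then the norms of values
are dominated. -/
theorem NonUnitalStarAlgHom.norm_apply_le_of_ker_le {B : Type v} {B' : Type w}
    [NonUnitalCStarAlgebra B] [NonUnitalCStarAlgebra B'] (φ : A →⋆ₙₐ[ℂ] B) (φ' : A →⋆ₙₐ[ℂ] B')
    (h : ∀ a, φ a = 0 → φ' a = 0) (a : A) : ‖φ' a‖ ≤ ‖φ a‖ := by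
  suffices hs : ‖φ' (star a * a)‖ ≤ ‖φ (star a * a)‖ by
    rw [map_mul, map_mul, map_star, map_star, CStarRing.norm_star_mul_self,
      CStarRing.norm_star_mul_self] at hs
    exact (mul_self_le_mul_self_iff (norm_nonneg _) (norm_nonneg _)).2 hs
  have hc : IsSelfAdjoint (star a * a) := IsSelfAdjoint.star_mul_self a
  set c := star a * a
  set δ := ‖φ c‖ with hδ
  have hδ0 : 0 ≤ δ := norm_nonneg _
  -- `f` is the excess of `t` over its truncation to `[-δ, δ]`. It vanishes on the spectrum of `φ
  -- c`, so `f(c)` is killed by `φ`, hence by `φ'`, and `φ' c` is the image of the truncation of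
  -- `c`, of norm at most `δ`.
  set f : ℝ → ℝ := fun t => t - max (-δ) (min t δ) with hf
  have hfc : Continuous f := by fun_prop
  have hf0 : f 0 = 0 := by simp [hf, hδ0]
  have h0 : φ (cfcₙ f c) = 0 := by
    rw [NonUnitalStarAlgHomClass.map_cfcₙ (S := ℂ) φ f c hfc.continuousOn hf0
      (NonUnitalStarAlgHom.continuous' φ) hc
      (hc.map φ), ← cfcₙ_zero ℝ (φ c)]
    refine cfcₙ_congr fun t ht => ?_
    have h1 : ‖t‖ ≤ δ := by
      have := NonUnitalIsometricContinuousFunctionalCalculus.norm_quasispectrum_le (φ c) ht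
        (hc.map φ)
      exact this
    rw [Real.norm_eq_abs, abs_le] at h1
    simp [hf, h1.1, h1.2]
  have h1 : φ' c = φ' (cfcₙ (fun t => t - f t) c) := by
    rw [cfcₙ_sub (fun t : ℝ => t) f c (by fun_prop) rfl hfc.continuousOn hf0, cfcₙ_id' ℝ c hc,
      map_sub, h _ h0, sub_zero]
  rw [h1]
  refine (NonUnitalStarAlgHom.norm_apply_le φ' _).trans (norm_cfcₙ_le fun t _ => ?_)
  rw [Real.norm_eq_abs, abs_le]
  simp only [hf, sub_sub_cancel]
  exact ⟨le_max_left _ _, max_le (by linarith) (min_le_right _ _)⟩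

end CStarIdeals

/-! ### Closed ideals of `C₀(X)` -/

section ClosedIdealsC0

variable {X : Type u} [TopologicalSpace X]

theorem ZeroAtInftyContinuousMap.isCompact_le_norm (f : C₀(X, ℂ)) {ε : ℝ} (hε : 0 < ε) :
    IsCompact {x | ε ≤ ‖f x‖} := by
  have h : ∀ᶠ x in Filter.cocompact X, ‖f x‖ < ε := by
    have h0 := (zero_at_infty f).norm
    rw [norm_zero] at h0
    exact h0.eventually_lt_const hε
  obtain ⟨K, hK, hKs⟩ := Filter.mem_cocompact.1 h
  refine hK.of_isClosed_subset (isClosed_le continuous_const (map_continuous f).norm) fun x hx => ?_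
  by_contra hxK
  have h1 : ε ≤ ‖f x‖ := hx
  have h2 : ‖f x‖ < ε := hKs hxK
  exact absurd h1 (not_le.2 h2)

theorem ZeroAtInftyContinuousMap.norm_le_of_forall {f : C₀(X, ℂ)} {C : ℝ} (hC : 0 ≤ C)
    (h : ∀ x, ‖f x‖ ≤ C) : ‖f‖ ≤ C := by
  rw [← ZeroAtInftyContinuousMap.norm_toBCF_eq_norm]
  exact (BoundedContinuousFunction.norm_le hC).2 h

open scoped ComplexOrder in
/-- A closed ideal of `C₀(X)` contains every function which vanishes on its set of common zeros. -/
theorem ZeroAtInftyContinuousMap.mem_of_isClosed_ideal {J : Set C₀(X, ℂ)} (hJ : IsClosed J)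
    (h0 : 0 ∈ J) (hadd : ∀ f ∈ J, ∀ g ∈ J, f + g ∈ J) (hmul : ∀ f, ∀ g ∈ J, f * g ∈ J)
    {f : C₀(X, ℂ)} (hf : ∀ x, (∀ g ∈ J, g x = 0) → f x = 0) : f ∈ J := by
  refine hJ.closure_subset (Metric.mem_closure_iff.2 fun ε' hε' => ?_)
  set ε := ε' / 2 with hεdef
  have hε : 0 < ε := half_pos hε'
  set K := {x | ε ≤ ‖f x‖} with hK
  have hKc : IsCompact K := f.isCompact_le_norm hε
  -- Locally `star k * k` with `k ∈ J` and `k x ≠ 0` works. Such functions are nonnegative, so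
  -- finite sums over a cover of `K` do not cancel.
  obtain ⟨g, hgJ, hg0, hgK⟩ : ∃ g ∈ J, (∀ x, 0 ≤ g x) ∧ ∀ x ∈ K, g x ≠ 0 := by
    refine hKc.induction_on (p := fun s => ∃ g ∈ J, (∀ x, 0 ≤ g x) ∧ ∀ x ∈ s, g x ≠ 0)
      ⟨0, h0, fun x => le_rfl, by simp⟩ ?_ ?_ ?_
    · rintro s t hst ⟨g, hg, hg0, hgt⟩
      exact ⟨g, hg, hg0, fun x hx => hgt x (hst hx)⟩
    · rintro s t ⟨g, hg, hg0, hgs⟩ ⟨k, hk, hk0, hkt⟩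
      refine ⟨g + k, hadd g hg k hk, fun x => add_nonneg (hg0 x) (hk0 x), ?_⟩
      rintro x (hx | hx)
      · exact (add_pos_of_pos_of_nonneg ((hg0 x).lt_of_ne' (hgs x hx)) (hk0 x)).ne'
      · exact (add_pos_of_nonneg_of_pos (hg0 x) ((hk0 x).lt_of_ne' (hkt x hx))).ne'
    · intro x hx
      have hfx : f x ≠ 0 := fun h => by
        have : ε ≤ ‖f x‖ := hx
        rw [h, norm_zero] at this
        exact absurd this (not_le.2 hε)
      obtain ⟨k, hk, hkx⟩ : ∃ k ∈ J, k x ≠ 0 := by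
        by_contra! h
        exact hfx (hf x h)
      refine ⟨{y | k y ≠ 0}, mem_nhdsWithin_of_mem_nhds
        ((map_continuous k).continuousAt.eventually_ne hkx), star k * k, hmul _ _ hk,
        fun y => star_mul_self_nonneg (k y), fun y hy => ?_⟩
      exact mul_ne_zero (star_ne_zero.2 hy) hy
  have hgre : ∀ x, g x = ((g x).re : ℂ) := fun x => Complex.eq_re_of_ofReal_le (hg0 x)
  have hgre0 : ∀ x, 0 ≤ (g x).re := fun x => (Complex.nonneg_iff.1 (hg0 x)).1
  obtain ⟨B, hB⟩ : ∃ B, ∀ x ∈ K, ‖f x / g x‖ ≤ B :=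
    hKc.exists_bound_of_continuousOn
      ((map_continuous f).continuousOn.div (map_continuous g).continuousOn hgK)
  -- The approximant is `f g / (δ + g)`, with error `f δ / (δ + g)`. On `K` we have `|f| ≤ B' g`, so
  -- the error is at most `B' δ = ε`; off `K` it is at most `|f| < ε`. The summand `1` makes `B'`
  -- positive.
  set B' := max B 0 + 1 with hB'
  have hB'0 : 0 < B' := by positivity
  set δ := ε / B' with hδdef
  have hδ : 0 < δ := by positivity
  have hden : ∀ x, (δ : ℂ) + g x = ((δ + (g x).re : ℝ) : ℂ) := fun x => by
    rw [hgre x]; simp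
  have hdpos : ∀ x, 0 < δ + (g x).re := fun x => by linarith [hgre0 x]
  have hdne : ∀ x, (δ : ℂ) + g x ≠ 0 := fun x => by
    rw [hden]; exact_mod_cast (hdpos x).ne'
  have hkc : Continuous fun x => f x / (δ + g x) :=
    (map_continuous f).div (continuous_const.add (map_continuous g)) hdne
  let k : C₀(X, ℂ) :=
    { toFun := fun x => f x / (δ + g x)
      continuous_toFun := hkc
      zero_at_infty' := by
        have h1 : Filter.Tendsto (fun x => ‖f x‖ / δ) (Filter.cocompact X) (𝓝 0) := by
          simpa using (zero_at_infty f).norm.div_const δ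
        refine squeeze_zero_norm (fun x => ?_) h1
        rw [norm_div, hden, Complex.norm_real, Real.norm_of_nonneg (hdpos x).le]
        gcongr
        linarith [hgre0 x] }
  refine ⟨k * g, hmul k g hgJ, ?_⟩
  rw [dist_eq_norm]
  refine lt_of_le_of_lt (ZeroAtInftyContinuousMap.norm_le_of_forall hε.le fun x => ?_)
    (half_lt_self hε')
  have h1 : (f - k * g) x = f x * (δ / (δ + g x)) := by
    change f x - f x / (δ + g x) * g x = _
    have := hdne x
    field_simp
    ring
  rw [h1, norm_mul, norm_div, hden, Complex.norm_real, Complex.norm_real,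
    Real.norm_of_nonneg (hdpos x).le, Real.norm_of_nonneg hδ.le]
  by_cases hx : x ∈ K
  · have h2 := hB x hx
    have hgx : 0 < (g x).re := (hgre0 x).lt_of_ne' fun h => hgK x hx (by rw [hgre x, h]; simp)
    have h3 : ‖g x‖ = (g x).re := by
      rw [hgre x, Complex.norm_real, Complex.ofReal_re, Real.norm_of_nonneg hgx.le]
    rw [norm_div, h3, div_le_iff₀ hgx] at h2
    have h4 : ‖f x‖ ≤ B' * (g x).re :=
      h2.trans (by gcongr; rw [hB']; linarith [le_max_left B 0])
    rw [← mul_div_assoc, div_le_iff₀ (hdpos x)]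
    calc ‖f x‖ * δ ≤ B' * (g x).re * δ := by gcongr
      _ = ε * (g x).re := by rw [hδdef]; field_simp
      _ ≤ ε * (δ + (g x).re) := by gcongr; linarith
  · have h2 : ‖f x‖ < ε := not_le.1 hx
    have h3 : δ / (δ + (g x).re) ≤ 1 := div_le_one_of_le₀ (by linarith [hgre0 x]) (hdpos x).le
    calc _ ≤ ‖f x‖ * 1 := by gcongr
      _ ≤ ε := by linarith

/-- For every closed set `C` and every point outside `C` there is a function supported off
`C` which does not vanish at the point. -/
theorem ZeroAtInftyContinuousMap.exists_ne_zero_of_notMem [T2Space X] [LocallyCompactSpace X]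
    {C : Set X} (hC : IsClosed C) {x : X} (hx : x ∉ C) :
    ∃ f : C₀(X, ℂ), f x = 1 ∧ tsupport f ⊆ Cᶜ := by
  obtain ⟨L, hL, hxL, hLC⟩ := exists_compact_subset hC.isOpen_compl hx
  obtain ⟨φ, h1, h0, hφ, -⟩ := exists_continuous_one_zero_of_isCompact (isCompact_singleton (x := x))
    (isOpen_interior (s := L)).isClosed_compl (by simpa using hxL)
  have hsup : tsupport (fun x => (φ x : ℂ)) ⊆ L := by
    refine closure_minimal (fun y hy => ?_) hL.isClosed
    by_contra hyL
    exact hy (by simp [h0 (show y ∈ (interior L)ᶜ from fun h => hyL (interior_subset h))])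
  have hcs : HasCompactSupport (fun x => (φ x : ℂ)) := HasCompactSupport.of_support_subset_isCompact
    hL ((subset_tsupport _).trans hsup)
  refine ⟨⟨⟨fun x => (φ x : ℂ), by fun_prop⟩, hcs.is_zero_at_infty⟩, ?_, hsup.trans hLC⟩
  exact (congrArg Complex.ofReal (h1 rfl)).trans Complex.ofReal_one

end ClosedIdealsC0

/-! ### Cutoff functions and the inner product on `C_c(U)` -/

namespace SGDS

theorem exists_cutoff {Y : Type u} [TopologicalSpace Y] [T2Space Y] [LocallyCompactSpace Y]
    {K V : Set Y} (hK : IsCompact K) (hV : IsOpen V) (hKV : K ⊆ V) :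
    ∃ ζ : C_c(Y, ℂ), tsupport ζ ⊆ V ∧ ∀ y ∈ K, ζ y = 1 := by
  obtain ⟨L, hL, hKL, hLV⟩ := exists_compact_between hK hV hKV
  obtain ⟨φ, h1, h0, hφ, -⟩ := exists_continuous_one_zero_of_isCompact hK
    (isOpen_interior (s := L)).isClosed_compl (Set.disjoint_compl_right_iff_subset.2 hKL)
  have hsup : tsupport (fun x => (φ x : ℂ)) ⊆ L := by
    refine closure_minimal (fun y hy => ?_) hL.isClosed
    by_contra hyL
    exact hy (by simp [h0 (show y ∈ (interior L)ᶜ from fun h => hyL (interior_subset h))])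
  have hcs : HasCompactSupport (fun x => (φ x : ℂ)) := HasCompactSupport.of_support_subset_isCompact
    hL ((subset_tsupport _).trans hsup)
  exact ⟨⟨⟨fun x => (φ x : ℂ), by fun_prop⟩, hcs⟩, hsup.trans hLV,
    fun y hy => (congrArg Complex.ofReal (h1 hy)).trans Complex.ofReal_one⟩

variable {X : Type u} [TopologicalSpace X] (S : SGDS X)

/-- The function `f ∘ σ`. -/
noncomputable def pull (f : C₀(X, ℂ)) : C(S.U, ℂ) :=
  ⟨fun y => f (S.σ y), (map_continuous f).comp S.isLocalHomeomorph.continuous⟩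

/-- The function `f|_U`. -/
noncomputable def resU (f : C₀(X, ℂ)) : C(S.U, ℂ) :=
  ⟨fun y => f y, (map_continuous f).comp continuous_subtype_val⟩

theorem tsupport_smul_subset {Y : Type v} [TopologicalSpace Y] (f : C(Y, ℂ)) (ξ : C_c(Y, ℂ)) :
    tsupport (f • ξ) ⊆ tsupport ξ :=
  closure_mono fun y hy h => hy (show f y * ξ y = 0 by rw [h, mul_zero])

theorem exists_injOn_nhds (y : S.U) : ∃ V : Set S.U, IsOpen V ∧ y ∈ V ∧ Set.InjOn S.σ V := by
  obtain ⟨e, hy, he⟩ := S.isLocalHomeomorph y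
  exact ⟨e.source, e.open_source, hy, by rw [he]; exact e.injOn⟩

/-- Every element of `C_c(U)` is a finite sum of elements supported in open sets on which `σ` is
injective. -/
theorem exists_sum_of_injOn [T2Space X] [LocallyCompactSpace X] (ξ : C_c(S.U, ℂ)) :
    ∃ (n : ℕ) (ξ' : Fin n → C_c(S.U, ℂ)), ξ = ∑ i, ξ' i ∧
      ∀ i, ∃ V : Set S.U, IsOpen V ∧ Set.InjOn S.σ V ∧ tsupport (ξ' i) ⊆ V := by
  have : LocallyCompactSpace S.U := S.U.isOpen.locallyCompactSpace
  choose V hV hyV hinj using S.exists_injOn_nhds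
  obtain ⟨t, ht⟩ := ξ.hasCompactSupport.isCompact.elim_finite_subcover V hV
    fun y _ => Set.mem_iUnion.2 ⟨y, hyV y⟩
  obtain ⟨p, hps, hp1, -, -⟩ := exists_continuous_sum_one_of_isOpen_isCompact
    (s := fun i : Fin t.card => V (t.equivFin.symm i)) (fun i => hV _)
    ξ.hasCompactSupport.isCompact (fun y hy => by
      obtain ⟨z, hz, hyz⟩ := Set.mem_iUnion₂.1 (ht hy)
      exact Set.mem_iUnion.2 ⟨t.equivFin ⟨z, hz⟩, by simpa using hyz⟩)
  refine ⟨t.card, fun i => (⟨fun y => (p i y : ℂ), by fun_prop⟩ : C(S.U, ℂ)) • ξ, ?_, fun i =>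
    ⟨_, hV _, hinj (t.equivFin.symm i), ?_⟩⟩
  · ext y
    rw [CompactlySupportedContinuousMap.coe_sum, Finset.sum_apply]
    change ξ y = ∑ i, (p i y : ℂ) * ξ y
    rw [← Finset.sum_mul]
    by_cases hy : y ∈ tsupport ξ
    · have h1 := hp1 hy
      rw [Finset.sum_apply, Pi.one_apply] at h1
      rw [← Complex.ofReal_sum, h1, Complex.ofReal_one, one_mul]
    · rw [image_eq_zero_of_notMem_tsupport hy, mul_zero]
  · refine (closure_mono fun y hy => ?_).trans (hps i)
    intro h
    refine hy ?_
    change (p i y : ℂ) * ξ y = 0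
    rw [h, Complex.ofReal_zero, zero_mul]

variable [T2Space X]

theorem ip_apply (ξ η : C_c(S.U, ℂ)) (x : X) :
    S.ip ξ η x = ∑ᶠ (y : S.U) (_ : S.σ y = x), star (ξ y) * η y := rfl

theorem ip_smul_right (ξ η : C_c(S.U, ℂ)) (f : C₀(X, ℂ)) :
    S.ip ξ (S.pull f • η) = S.ip ξ η * f := by
  ext x
  rw [ZeroAtInftyContinuousMap.mul_apply, ip_apply, ip_apply]
  have h := finsum_mem_mul (s := {y | S.σ y = x}) (fun y => star (ξ y) * η y) (f x)
  refine Eq.trans ?_ h.symm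
  refine finsum_mem_congr rfl fun y hy => ?_
  have hy' : S.σ y = x := hy
  change star (ξ y) * (f (S.σ y) * η y) = _
  rw [hy']
  ring

theorem star_ip (ξ η : C_c(S.U, ℂ)) : star (S.ip ξ η) = S.ip η ξ := by
  ext x
  change star (S.ip ξ η x) = _
  rw [ip_apply, ip_apply]
  refine ((starAddEquiv : ℂ ≃+ ℂ).map_finsum _).trans (finsum_congr fun y => ?_)
  refine ((starAddEquiv : ℂ ≃+ ℂ).map_finsum _).trans (finsum_congr fun _ => ?_)
  change star (star (ξ y) * η y) = _
  rw [star_mul, star_star]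

theorem ip_smul_left (ξ η : C_c(S.U, ℂ)) (f : C₀(X, ℂ)) :
    S.ip (S.pull f • ξ) η = star f * S.ip ξ η := by
  rw [← star_ip, ip_smul_right, ← star_ip S η ξ]
  ext x
  change star (S.ip η ξ x * f x) = star (f x) * star (S.ip η ξ x)
  exact star_mul _ _

theorem ip_apply_of_injOn {V : Set S.U} (hi : Set.InjOn S.σ V) {ζ ξ : C_c(S.U, ℂ)}
    (hζ : tsupport ζ ⊆ V) {y : S.U} (hy : y ∈ V) : S.ip ζ ξ (S.σ y) = star (ζ y) * ξ y := by
  classical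
  rw [ip_apply]
  refine (finsum_eq_single _ y fun z hz => ?_).trans (finsum_eq_if.trans (if_pos rfl))
  refine finsum_eq_if.trans (ite_eq_right_iff.2 fun hzy => ?_)
  rw [image_eq_zero_of_notMem_tsupport fun h => hz (hi (hζ h) hy hzy), star_zero, zero_mul]

theorem ip_eq_zero_of_notMem_image {ζ ξ : C_c(S.U, ℂ)} {x : X} (hx : x ∉ S.σ '' tsupport ζ) :
    S.ip ζ ξ x = 0 := by
  rw [ip_apply]
  refine finsum_mem_eq_zero_of_forall_eq_zero fun y hy => ?_
  rw [image_eq_zero_of_notMem_tsupport fun h => hx ⟨y, h, hy⟩, star_zero, zero_mul]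

/-- Over a set on which `σ` is injective the fibre sum has a single term, so `⟨ζ, ξ⟩ ∘ σ` recovers
`ξ`. This lets `t1 ξ` be written as `t1 ζ * t0 ⟨ζ, ξ⟩` with a fixed cutoff `ζ`. -/
theorem eq_pull_ip_smul {V : Set S.U} (hi : Set.InjOn S.σ V) {ζ ξ : C_c(S.U, ℂ)}
    (hζ : tsupport ζ ⊆ V) (hξ : ∀ y ∈ tsupport ξ, ζ y = 1) :
    S.pull (S.ip ζ ξ) • ζ = ξ := by
  have hξV : tsupport ξ ⊆ V := fun y hy => hζ (subset_tsupport _ (by simp [hξ y hy]))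
  ext y
  change S.ip ζ ξ (S.σ y) * ζ y = ξ y
  by_cases hyV : y ∈ V
  · rw [S.ip_apply_of_injOn hi hζ hyV]
    by_cases hy : y ∈ tsupport ξ
    · simp [hξ y hy]
    · simp [image_eq_zero_of_notMem_tsupport hy]
  · rw [image_eq_zero_of_notMem_tsupport fun h => hyV (hζ h),
      image_eq_zero_of_notMem_tsupport fun h => hyV (hξV h), mul_zero]

/-! ### `C₀(X)`-bimodule relations in a representation -/

namespace Rep

variable {S} {A : Type w} [NonUnitalCStarAlgebra A] (π : S.Rep A)

/-- Let `d` be the difference of the two sides. By relation (i), the four terms of `d* d` are all `±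
t0(f̄ ⟨ξ, ξ⟩ f)` and cancel. -/
theorem t1_mul_t0 (ξ : C_c(S.U, ℂ)) (f : C₀(X, ℂ)) :
    π.t1 ξ * π.t0 f = π.t1 (S.pull f • ξ) := by
  rw [← sub_eq_zero, ← CStarRing.star_mul_self_eq_zero_iff, star_sub, star_mul, mul_sub, sub_mul,
    sub_mul]
  have h1 : star (π.t0 f) * star (π.t1 ξ) * (π.t1 ξ * π.t0 f) =
      π.t0 (star f * S.ip ξ ξ * f) := by
    rw [map_mul, map_mul, map_star, ← π.star_t1_mul_t1]
    simp only [mul_assoc]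
  have h2 : star (π.t1 (S.pull f • ξ)) * (π.t1 ξ * π.t0 f) = π.t0 (star f * S.ip ξ ξ * f) := by
    rw [← mul_assoc, π.star_t1_mul_t1, ip_smul_left, ← map_mul]
  have h3 : star (π.t0 f) * star (π.t1 ξ) * π.t1 (S.pull f • ξ) =
      π.t0 (star f * S.ip ξ ξ * f) := by
    rw [mul_assoc, π.star_t1_mul_t1, ip_smul_right, ← map_star, ← map_mul, mul_assoc]
  rw [h1, h2, h3, π.star_t1_mul_t1, ip_smul_left, ip_smul_right, mul_assoc]
  simp

variable [LocallyCompactSpace X]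

/-- For a cutoff `ζ` equal to `1` on the support of `ξ`, both relations give `t1 ξ = t1 ζ (t1 ζ)* t1
ξ = t0(|ζ|²) t1 ξ`. Now `f |ζ|² = (f ζ) ζ̄`, and (ii) in the reverse direction moves `f` into `t1`.
-/
theorem t0_mul_t1_of_injOn {V : Set S.U} (hV : IsOpen V) (hi : Set.InjOn S.σ V)
    {ξ : C_c(S.U, ℂ)} (hξ : tsupport ξ ⊆ V) (f : C₀(X, ℂ)) :
    π.t0 f * π.t1 ξ = π.t1 (S.resU f • ξ) := by
  have : LocallyCompactSpace S.U := S.U.isOpen.locallyCompactSpace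
  obtain ⟨ζ, hζV, hζ1⟩ := exists_cutoff ξ.hasCompactSupport.isCompact hV hξ
  have h1 : π.t1 ξ = π.t0 (S.extend (ζ * star ζ)) * π.t1 ξ := by
    conv_lhs => rw [← S.eq_pull_ip_smul hi hζV hζ1, ← π.t1_mul_t0, ← π.star_t1_mul_t1]
    rw [← mul_assoc, π.t1_mul_star_t1 V hV hi ζ ζ hζV hζV]
  have h2 : f * S.extend (ζ * star ζ) = S.extend ((S.resU f • ζ) * star ζ) := by
    ext x
    by_cases hx : x ∈ S.U
    · have e1 := extend_apply S (ζ * star ζ) ⟨x, hx⟩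
      have e2 := extend_apply S ((S.resU f • ζ) * star ζ) ⟨x, hx⟩
      refine Eq.trans ?_ e2.symm
      refine (congrArg (f x * ·) e1).trans ?_
      change f x * (ζ ⟨x, hx⟩ * star (ζ ⟨x, hx⟩)) = f x * ζ ⟨x, hx⟩ * star (ζ ⟨x, hx⟩)
      ring
    · rw [ZeroAtInftyContinuousMap.mul_apply, extend_apply_of_notMem S _ hx,
        extend_apply_of_notMem S _ hx, mul_zero]
  rw [h1, ← mul_assoc, ← map_mul, h2, ← π.t1_mul_star_t1 V hV hi _ ζ
    ((tsupport_smul_subset _ _).trans hζV) hζV, mul_assoc, π.star_t1_mul_t1, π.t1_mul_t0]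
  congr 1
  conv_rhs => rw [← S.eq_pull_ip_smul hi hζV hζ1]
  ext y
  change S.ip ζ ξ (S.σ y) * (f y * ζ y) = f y * (S.ip ζ ξ (S.σ y) * ζ y)
  ring

theorem t0_mul_t1 (f : C₀(X, ℂ)) (ξ : C_c(S.U, ℂ)) :
    π.t0 f * π.t1 ξ = π.t1 (S.resU f • ξ) := by
  obtain ⟨n, ξ', rfl, h⟩ := S.exists_sum_of_injOn ξ
  have hs : S.resU f • ∑ i, ξ' i = ∑ i, S.resU f • ξ' i := by
    ext y
    rw [CompactlySupportedContinuousMap.coe_sum, Finset.sum_apply]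
    change f y * (∑ i, ξ' i : C_c(S.U, ℂ)) y = ∑ i, f y * ξ' i y
    rw [CompactlySupportedContinuousMap.coe_sum, Finset.sum_apply, Finset.mul_sum]
  rw [hs, map_sum, map_sum, Finset.mul_sum]
  refine Finset.sum_congr rfl fun i _ => ?_
  obtain ⟨V, hV, hi, hξ⟩ := h i
  exact π.t0_mul_t1_of_injOn hV hi hξ f

/-- Take `f` to be a cutoff equal to `1` on the compact set `σ(supp ξ)`. This and the next lemma
express that `C₀(X)` acts nondegenerately. -/
theorem exists_t1_mul_t0_eq (ξ : C_c(S.U, ℂ)) : ∃ f : C₀(X, ℂ), π.t1 ξ = π.t1 ξ * π.t0 f := by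
  obtain ⟨ζ, -, hζ⟩ := exists_cutoff (ξ.hasCompactSupport.isCompact.image
    S.isLocalHomeomorph.continuous) isOpen_univ (Set.subset_univ _)
  refine ⟨⟨⟨ζ, map_continuous ζ⟩, ζ.hasCompactSupport.is_zero_at_infty⟩, ?_⟩
  rw [π.t1_mul_t0]
  congr 1
  ext y
  change ξ y = ζ (S.σ y) * ξ y
  by_cases hy : y ∈ tsupport ξ
  · rw [hζ _ ⟨y, hy, rfl⟩, one_mul]
  · rw [image_eq_zero_of_notMem_tsupport hy, mul_zero]

theorem exists_t0_mul_t1_eq (ξ : C_c(S.U, ℂ)) : ∃ f : C₀(X, ℂ), π.t1 ξ = π.t0 f * π.t1 ξ := by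
  obtain ⟨ζ, -, hζ⟩ := exists_cutoff (ξ.hasCompactSupport.isCompact.image
    continuous_subtype_val) isOpen_univ (Set.subset_univ _)
  refine ⟨⟨⟨ζ, map_continuous ζ⟩, ζ.hasCompactSupport.is_zero_at_infty⟩, ?_⟩
  rw [π.t0_mul_t1]
  congr 1
  ext y
  change ξ y = ζ y * ξ y
  by_cases hy : y ∈ tsupport ξ
  · rw [hζ _ ⟨y, hy, rfl⟩, one_mul]
  · rw [image_eq_zero_of_notMem_tsupport hy, mul_zero]

end Rep

end SGDS

/-! ### The representation on `ℓ²(X)` and injectivity of `t0` -/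

namespace SGDS

section OrbitRep

variable {X : Type u}

/-- A bounded operator on `ℓ²(X)`, from a linear map on functions with a bound. -/
noncomputable def lpOp (T : (X → ℂ) →ₗ[ℂ] (X → ℂ)) (C : ℝ) (hC : 0 ≤ C)
    (h : ∀ (g : lp (fun _ : X => ℂ) 2) (s : Finset X),
      ∑ x ∈ s, ‖T g x‖ ^ 2 ≤ C ^ 2 * ‖g‖ ^ 2) :
    lp (fun _ : X => ℂ) 2 →L[ℂ] lp (fun _ : X => ℂ) 2 :=
  LinearMap.mkContinuous
    { toFun g := ⟨T g, memℓp_gen' (C := C ^ 2 * ‖g‖ ^ 2) fun s => by simpa using h g s⟩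
      map_add' g k := Subtype.ext (T.map_add g k)
      map_smul' c g := Subtype.ext (T.map_smul c g) }
    C fun g => lp.norm_le_of_forall_sum_le (by simp) (by positivity) fun s => by
      simpa [mul_pow] using h g s

theorem lp_sum_sq_le (g : lp (fun _ : X => ℂ) 2) (s : Finset X) :
    ∑ x ∈ s, ‖g x‖ ^ 2 ≤ ‖g‖ ^ 2 := by
  simpa using lp.sum_rpow_le_norm_rpow (p := 2) (by simp) g s

theorem lp_star_apply (T : lp (fun _ : X => ℂ) 2 →L[ℂ] lp (fun _ : X => ℂ) 2)
    (g : lp (fun _ : X => ℂ) 2) (x : X) [DecidableEq X] :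
    (star T) g x = ∑' y, star (T (lp.single 2 x 1) y) * g y := by
  have h1 := lp.inner_single_left (𝕜 := ℂ) (G := fun _ : X => ℂ) x 1 ((star T) g)
  rw [ContinuousLinearMap.star_eq_adjoint, ContinuousLinearMap.adjoint_inner_right,
    lp.inner_eq_tsum] at h1
  rw [ContinuousLinearMap.star_eq_adjoint]
  simpa [mul_comm] using h1.symm

variable [TopologicalSpace X] (S : SGDS X)

/-- Multiplication by `f`, as an operator on functions. -/
noncomputable def mulLin (f : C₀(X, ℂ)) : (X → ℂ) →ₗ[ℂ] (X → ℂ) where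
  toFun g x := f x * g x
  map_add' g k := by ext x; simp [mul_add]
  map_smul' c g := by ext x; simp [mul_left_comm]

/-- Multiplication by `f` on `ℓ²(X)`. -/
noncomputable def mulOp (f : C₀(X, ℂ)) : lp (fun _ : X => ℂ) 2 →L[ℂ] lp (fun _ : X => ℂ) 2 :=
  lpOp (mulLin f) ‖f‖ (norm_nonneg f) fun g s => by
    have h : ∀ x, ‖f x‖ ≤ ‖f‖ := fun x => by
      have h3 := BoundedContinuousFunction.norm_coe_le_norm f.toBCF x
      rwa [ZeroAtInftyContinuousMap.norm_toBCF_eq_norm] at h3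
    calc ∑ x ∈ s, ‖f x * g x‖ ^ 2 ≤ ∑ x ∈ s, ‖f‖ ^ 2 * ‖g x‖ ^ 2 := by
          refine Finset.sum_le_sum fun x _ => ?_
          rw [norm_mul, mul_pow]
          gcongr
          exact h x
      _ = ‖f‖ ^ 2 * ∑ x ∈ s, ‖g x‖ ^ 2 := Finset.mul_sum _ _ _ |>.symm
      _ ≤ _ := by gcongr; exact lp_sum_sq_le g s

theorem mulOp_apply (f : C₀(X, ℂ)) (g : lp (fun _ : X => ℂ) 2) (x : X) :
    mulOp f g x = f x * g x := rfl

open Classical in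
/-- The operator `g ↦ ξ · (g ∘ σ)` on functions. -/
noncomputable def shiftLin (ξ : C_c(S.U, ℂ)) : (X → ℂ) →ₗ[ℂ] (X → ℂ) where
  toFun g x := if h : x ∈ S.U then ξ ⟨x, h⟩ * g (S.σ ⟨x, h⟩) else 0
  map_add' g k := by ext x; by_cases h : x ∈ S.U <;> simp [h, mul_add]
  map_smul' c g := by ext x; by_cases h : x ∈ S.U <;> simp [h, mul_left_comm]

theorem shiftLin_coe (ξ : C_c(S.U, ℂ)) (g : X → ℂ) (y : S.U) :
    S.shiftLin ξ g y = ξ y * g (S.σ y) := dif_pos y.2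

theorem shiftLin_of_notMem (ξ : C_c(S.U, ℂ)) (g : X → ℂ) {x : X} (hx : x ∉ S.U) :
    S.shiftLin ξ g x = 0 := dif_neg hx

variable [T2Space X] [LocallyCompactSpace X]

/-- Each summand of `ξ` supported where `σ` is injective contributes at most one point. -/
theorem finite_fiber (ξ : C_c(S.U, ℂ)) (x : X) : {y | S.σ y = x ∧ ξ y ≠ 0}.Finite := by
  obtain ⟨n, ξ', hsum, h⟩ := S.exists_sum_of_injOn ξ
  have hsub : {y | S.σ y = x ∧ ξ y ≠ 0} ⊆ ⋃ i, {y | S.σ y = x ∧ ξ' i y ≠ 0} := by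
    rintro y ⟨hy, hne⟩
    rw [hsum, CompactlySupportedContinuousMap.coe_sum, Finset.sum_apply] at hne
    obtain ⟨i, -, hi⟩ := Finset.exists_ne_zero_of_sum_ne_zero hne
    exact Set.mem_iUnion.2 ⟨i, hy, hi⟩
  refine (Set.finite_iUnion fun i => Set.Subsingleton.finite ?_).subset hsub
  obtain ⟨V, -, hinj, hV⟩ := h i
  rintro y ⟨hy, hne⟩ z ⟨hz, hne'⟩
  exact hinj (hV (subset_tsupport _ hne)) (hV (subset_tsupport _ hne')) (hy.trans hz.symm)

theorem sum_norm_sq_le_norm_ip (ξ : C_c(S.U, ℂ)) (x : X) (t : Finset S.U)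
    (ht : ∀ y ∈ t, S.σ y = x) : ∑ y ∈ t, ‖ξ y‖ ^ 2 ≤ ‖S.ip ξ ξ‖ := by
  classical
  set F := (S.finite_fiber ξ x).toFinset with hF
  have h1 : S.ip ξ ξ x = ((∑ y ∈ F, ‖ξ y‖ ^ 2 : ℝ) : ℂ) := by
    rw [ip_apply, Complex.ofReal_sum]
    refine (finsum_mem_eq_sum_of_inter_support_eq (s := {y | S.σ y = x}) (t := F) _ ?_).trans
      (Finset.sum_congr rfl fun y _ => ?_)
    · ext y
      simp [hF]
    · rw [Complex.star_def, ← Complex.normSq_eq_conj_mul_self, Complex.normSq_eq_norm_sq]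
  have h2 : ∑ y ∈ t, ‖ξ y‖ ^ 2 ≤ ∑ y ∈ F, ‖ξ y‖ ^ 2 := by
    rw [← Finset.sum_filter_ne_zero (s := t)]
    refine Finset.sum_le_sum_of_subset_of_nonneg (fun y hy => ?_) fun _ _ _ => by positivity
    rw [Finset.mem_filter] at hy
    rw [hF, Set.Finite.mem_toFinset]
    exact ⟨ht y hy.1, fun h => hy.2 (by simp [h])⟩
  refine h2.trans ?_
  have h3 := BoundedContinuousFunction.norm_coe_le_norm (S.ip ξ ξ).toBCF x
  rw [ZeroAtInftyContinuousMap.norm_toBCF_eq_norm] at h3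
  have h4 : ‖S.ip ξ ξ x‖ ≤ ‖S.ip ξ ξ‖ := h3
  rw [h1, Complex.norm_real] at h4
  exact (le_abs_self _).trans h4

/-- The operator `g ↦ ξ · (g ∘ σ)` on `ℓ²(X)`. -/
noncomputable def shiftOp (ξ : C_c(S.U, ℂ)) :
    lp (fun _ : X => ℂ) 2 →L[ℂ] lp (fun _ : X => ℂ) 2 :=
  lpOp (S.shiftLin ξ) √‖S.ip ξ ξ‖ (Real.sqrt_nonneg _) fun g s => by
    classical
    rw [Real.sq_sqrt (norm_nonneg _)]
    set t : Finset S.U := s.subtype (· ∈ S.U) with ht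
    have h1 : ∑ x ∈ s, ‖S.shiftLin ξ g x‖ ^ 2 = ∑ y ∈ t, ‖ξ y‖ ^ 2 * ‖g (S.σ y)‖ ^ 2 := by
      have e1 : ∑ x ∈ s with x ∈ S.U, ‖S.shiftLin ξ g x‖ ^ 2 =
          ∑ x ∈ s, ‖S.shiftLin ξ g x‖ ^ 2 :=
        Finset.sum_filter_of_ne fun x _ hx => by
          by_contra h
          exact hx (by rw [S.shiftLin_of_notMem ξ g h]; simp)
      rw [← e1, ← Finset.sum_subtype_eq_sum_filter]
      refine Finset.sum_congr rfl fun y _ => ?_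
      rw [S.shiftLin_coe, norm_mul, mul_pow]
    -- Grouped by fibres, the points above `x` contribute `(∑ |ξ y|²) |g x|²`, and the fibre sum is
    -- bounded by `‖⟨ξ, ξ⟩‖`.
    rw [h1, ← Finset.sum_fiberwise_of_maps_to (t := t.image S.σ) (g := S.σ)
      fun y hy => Finset.mem_image_of_mem _ hy]
    calc _ ≤ ∑ x ∈ t.image S.σ, ‖S.ip ξ ξ‖ * ‖g x‖ ^ 2 := by
          refine Finset.sum_le_sum fun x _ => ?_
          have e2 : ∑ y ∈ t with S.σ y = x, ‖ξ y‖ ^ 2 * ‖g (S.σ y)‖ ^ 2 =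
              (∑ y ∈ t with S.σ y = x, ‖ξ y‖ ^ 2) * ‖g x‖ ^ 2 := by
            rw [Finset.sum_mul]
            refine Finset.sum_congr rfl fun y hy => ?_
            rw [(Finset.mem_filter.1 hy).2]
          rw [e2]
          gcongr
          exact S.sum_norm_sq_le_norm_ip ξ x _ fun y hy => (Finset.mem_filter.1 hy).2
      _ = ‖S.ip ξ ξ‖ * ∑ x ∈ t.image S.σ, ‖g x‖ ^ 2 := Finset.mul_sum _ _ _ |>.symm
      _ ≤ _ := by gcongr; exact lp_sum_sq_le g _

theorem shiftOp_coe (ξ : C_c(S.U, ℂ)) (g : lp (fun _ : X => ℂ) 2) (y : S.U) :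
    S.shiftOp ξ g y = ξ y * g (S.σ y) := S.shiftLin_coe ξ g y

theorem shiftOp_of_notMem (ξ : C_c(S.U, ℂ)) (g : lp (fun _ : X => ℂ) 2) {x : X} (hx : x ∉ S.U) :
    S.shiftOp ξ g x = 0 := S.shiftLin_of_notMem ξ g hx

/-- The matrix of the weighted shift has nonzero entries only at the pairs `(y, σ y)`. With this
form of the adjoint, relation (i) is the definition of `ip`. -/
theorem star_shiftOp_apply (η : C_c(S.U, ℂ)) (g : lp (fun _ : X => ℂ) 2) (x : X) :
    (star (S.shiftOp η)) g x = ∑ᶠ (y : S.U) (_ : S.σ y = x), star (η y) * g y := by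
  classical
  rw [lp_star_apply]
  set F := (S.finite_fiber η x).toFinset with hF
  rw [tsum_eq_sum (s := F.map (Function.Embedding.subtype _)), Finset.sum_map]
  · symm
    refine (finsum_mem_eq_sum_of_subset (s := {y | S.σ y = x}) (t := F) _ ?_ ?_).trans
      (Finset.sum_congr rfl fun y hy => ?_)
    · rintro y ⟨hy, hne⟩
      rw [hF, Set.Finite.coe_toFinset]
      exact ⟨hy, fun h => hne (by simp [h])⟩
    · rw [hF, Set.Finite.coe_toFinset]
      exact fun y hy => hy.1
    · rw [hF, Set.Finite.mem_toFinset] at hy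
      rw [Function.Embedding.subtype_apply, shiftOp_coe, hy.1, lp.single_apply_self, mul_one]
  · intro z hz
    by_cases hzU : z ∈ S.U
    · have e1 := S.shiftOp_coe η (lp.single 2 x 1) ⟨z, hzU⟩
      change S.shiftOp η (lp.single 2 x 1) z = _ at e1
      rw [e1]
      by_cases hzx : S.σ ⟨z, hzU⟩ = x
      · have : η ⟨z, hzU⟩ = 0 := by
          by_contra h
          exact hz (Finset.mem_map.2 ⟨⟨z, hzU⟩, hF ▸ (Set.Finite.mem_toFinset _).2 ⟨hzx, h⟩, rfl⟩)
        simp [this]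
      · rw [lp.single_apply_ne _ _ _ hzx]
        simp
    · rw [S.shiftOp_of_notMem _ _ hzU]
      simp

/-- The representation on `ℓ²(X)` by multiplication operators and weighted shifts. -/
noncomputable def orbitRep : S.Rep (lp (fun _ : X => ℂ) 2 →L[ℂ] lp (fun _ : X => ℂ) 2) where
  t0 :=
    { toFun := mulOp
      map_smul' c f := by ext g x; simp [mulOp_apply, mul_assoc]
      map_zero' := by ext g x; simp [mulOp_apply]
      map_add' f k := by ext g x; simp [mulOp_apply, add_mul]
      map_mul' f k := by ext g x; simp [mulOp_apply, mul_assoc]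
      map_star' f := by
        classical
        ext g x
        rw [lp_star_apply, tsum_eq_single x]
        · simp [mulOp_apply]
        · intro y hy
          rw [mulOp_apply, lp.single_apply_ne _ _ _ hy]
          simp }
  t1 :=
    { toFun := S.shiftOp
      map_add' ξ η := by
        ext g x
        by_cases hx : x ∈ S.U
        · have h := fun ζ => S.shiftOp_coe ζ g ⟨x, hx⟩
          simp only at h
          simp [h, add_mul]
        · simp [S.shiftOp_of_notMem _ _ hx]
      map_smul' c ξ := by
        ext g x
        by_cases hx : x ∈ S.U
        · have h := fun ζ => S.shiftOp_coe ζ g ⟨x, hx⟩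
          simp only at h
          simp [h, mul_assoc]
        · simp [S.shiftOp_of_notMem _ _ hx] }
  star_t1_mul_t1 ξ η := by
    ext g x
    change (star (S.shiftOp ξ)) (S.shiftOp η g) x = S.ip ξ η x * g x
    rw [star_shiftOp_apply, ip_apply]
    refine Eq.trans ?_
      (finsum_mem_mul (s := {y | S.σ y = x}) (fun y => star (ξ y) * η y) (g x)).symm
    refine finsum_mem_congr rfl fun y hy => ?_
    have hy' : S.σ y = x := hy
    rw [shiftOp_coe, hy', mul_assoc]
  t1_mul_star_t1 V hV hi ξ η hξ hη := by
    classical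
    ext g x
    change S.shiftOp ξ ((star (S.shiftOp η)) g) x = S.extend (ξ * star η) x * g x
    by_cases hx : x ∈ S.U
    · have h1 := S.shiftOp_coe ξ ((star (S.shiftOp η)) g) ⟨x, hx⟩
      have h2 := extend_apply S (ξ * star η) ⟨x, hx⟩
      simp only at h1 h2
      rw [h1, h2, star_shiftOp_apply]
      change _ = ξ ⟨x, hx⟩ * star (η ⟨x, hx⟩) * g x
      by_cases hxV : ⟨x, hx⟩ ∈ V
      · rw [mul_assoc]
        congr 1
        -- Since `η` is supported in `V` and `σ` is injective there, `x` is the only point of its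
        -- fibre that contributes.
        refine (finsum_eq_single _ ⟨x, hx⟩ fun z hz => ?_).trans (finsum_eq_if.trans (if_pos rfl))
        refine finsum_eq_if.trans (ite_eq_right_iff.2 fun hzy => ?_)
        rw [image_eq_zero_of_notMem_tsupport fun h => hz (hi (hη h) hxV hzy), star_zero, zero_mul]
      · rw [image_eq_zero_of_notMem_tsupport fun h => hxV (hξ h)]
        simp
    · rw [S.shiftOp_of_notMem _ _ hx, extend_apply_of_notMem S _ hx, zero_mul]

/-- On `ℓ²(X)` the value `f x` is the diagonal entry of `f` at the basis vector of `x`. -/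
theorem universal_t0_injective : Function.Injective S.universal.t0 := by
  classical
  intro f k h
  have h1 := congrArg (lift S.orbitRep) h
  rw [lift_t0, lift_t0] at h1
  ext x
  have h2 := congrArg (fun T : lp (fun _ : X => ℂ) 2 →L[ℂ] lp (fun _ : X => ℂ) 2 =>
    T (lp.single 2 x 1) x) h1
  have h3 : f x * lp.single (E := fun _ : X => ℂ) 2 x 1 x =
    k x * lp.single (E := fun _ : X => ℂ) 2 x 1 x := h2
  simpa using h3

theorem isClosed_range_universal_t0 : IsClosed (Set.range S.universal.t0) := by
  let _ : NonUnitalCStarAlgebra C₀(X, ℂ) := {}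
  exact (NonUnitalStarAlgHom.isometry S.universal.t0
    S.universal_t0_injective).isClosedEmbedding.isClosed_range

end OrbitRep

end SGDS

/-! ### The core and its local structure -/

namespace SGDS

theorem tsupport_star_eq {X : Type u} [TopologicalSpace X] (h : C₀(X, ℂ)) : tsupport (star h : C₀(X, ℂ)) = tsupport h := by
  have : Function.support (star h : C₀(X, ℂ)) = Function.support h := by
    ext x
    exact star_ne_zero
  rw [tsupport, tsupport, this]

variable {X : Type u} [TopologicalSpace X] [T2Space X] {S : SGDS X}

namespace Rep

variable {A : Type w} [NonUnitalCStarAlgebra A] (π : S.Rep A)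

/-- The elements of the `n`-th stage of the core whose coefficients are supported in `K`. -/
inductive Core (K : Set S.U) : ℕ → A → Prop
  | t0 (n : ℕ) (f : C₀(X, ℂ)) : Core K n (π.t0 f)
  | add (n : ℕ) (a b : A) : Core K n a → Core K n b → Core K n (a + b)
  | conj (n : ℕ) (ξ η : C_c(S.U, ℂ)) (b : A) : tsupport ξ ⊆ K → tsupport η ⊆ K → Core K n b →
      Core K (n + 1) (π.t1 ξ * b * star (π.t1 η))

namespace Core

variable {π} {K K' : Set S.U} {n m : ℕ} {a b : A}

/-- The index bounds the nesting depth rather than fixing it, since `t0 f` is admitted at every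
level. -/
theorem succ (h : π.Core K n b) : π.Core K (n + 1) b := by
  induction h with
  | t0 n f => exact .t0 _ f
  | add n a b _ _ ha hb => exact .add _ a b ha hb
  | conj n ξ η b hξ hη _ hb => exact .conj _ ξ η b hξ hη hb

theorem mono_right (hnm : n ≤ m) (h : π.Core K n b) : π.Core K m b := by
  induction hnm with
  | refl => exact h
  | step _ ih => exact ih.succ

theorem mono_left (hK : K ⊆ K') (h : π.Core K n b) : π.Core K' n b := by
  induction h with
  | t0 n f => exact .t0 _ f
  | add n a b _ _ ha hb => exact .add _ a b ha hb
  | conj n ξ η b hξ hη _ hb => exact .conj _ ξ η b (hξ.trans hK) (hη.trans hK) hb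

theorem zero (π : S.Rep A) (K : Set S.U) (n : ℕ) : π.Core K n 0 := by
  rw [← map_zero π.t0]
  exact .t0 n 0

theorem smul (c : ℂ) (h : π.Core K n b) : π.Core K n (c • b) := by
  induction h with
  | t0 n f => rw [← map_smul]; exact .t0 n _
  | add n a b _ _ ha hb => rw [smul_add]; exact .add n _ _ ha hb
  | conj n ξ η b hξ hη hb _ =>
    rw [← smul_mul_assoc, ← smul_mul_assoc, ← map_smul]
    exact .conj n _ η b ((tsupport_smul_subset (ContinuousMap.const _ c) ξ).trans hξ) hη hb

theorem star (h : π.Core K n b) : π.Core K n (star b) := by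
  induction h with
  | t0 n f => rw [← map_star]; exact .t0 n _
  | add n a b _ _ ha hb => rw [star_add]; exact .add n _ _ ha hb
  | conj n ξ η b hξ hη _ hb =>
    rw [star_mul, star_mul, star_star, ← mul_assoc]
    exact .conj n _ _ _ hη hξ hb

variable [LocallyCompactSpace X]

theorem t0_mul (f : C₀(X, ℂ)) (h : π.Core K n b) : π.Core K n (π.t0 f * b) := by
  induction h with
  | t0 n g => rw [← map_mul]; exact .t0 n _
  | add n a b _ _ ha hb => rw [mul_add]; exact .add n _ _ ha hb
  | conj n ξ η b hξ hη hb _ =>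
    rw [← mul_assoc, ← mul_assoc, π.t0_mul_t1]
    exact .conj n _ η b ((tsupport_smul_subset _ _).trans hξ) hη hb

theorem mul_t0 (f : C₀(X, ℂ)) (h : π.Core K n b) : π.Core K n (b * π.t0 f) := by
  have := (h.star.t0_mul (Star.star f)).star
  rwa [star_mul, star_star, map_star, star_star] at this

/-- In the product of two conjugates the inner pair `(t1 η)* t1 ξ'` collapses to `t0 ⟨η, ξ'⟩`,
leaving one conjugate of a product of depth one less. -/
theorem mul (ha : π.Core K n a) (hb : π.Core K n b) : π.Core K n (a * b) := by
  induction ha generalizing b with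
  | t0 n f => exact hb.t0_mul f
  | add n a a' _ _ iha iha' => rw [add_mul]; exact .add n _ _ (iha hb) (iha' hb)
  | conj n ξ η a hξ hη ha iha =>
    suffices H : ∀ m b, π.Core K m b → m = n + 1 →
        π.Core K (n + 1) (π.t1 ξ * a * Star.star (π.t1 η) * b) from H _ b hb rfl
    intro m b hb
    induction hb with
    | t0 m f => exact fun _ => (Core.conj n ξ η a hξ hη ha).mul_t0 f
    | add m b b' _ _ ihb ihb' =>
      intro hm
      rw [mul_add]
      exact .add _ _ _ (ihb hm) (ihb' hm)
    | conj m ξ' η' b hξ' hη' hbm _ =>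
      intro hm
      obtain rfl : m = n := by omega
      have h1 : π.t1 ξ * a * Star.star (π.t1 η) * (π.t1 ξ' * b * Star.star (π.t1 η')) =
          π.t1 ξ * (a * (π.t0 (S.ip η ξ') * b)) * Star.star (π.t1 η') := by
        rw [← π.star_t1_mul_t1]
        simp only [mul_assoc]
      rw [h1]
      exact .conj m ξ η' _ hξ hη' (iha (hbm.t0_mul _))

end Core

/-- The stages of the core are ⋆-subalgebras. -/
def coreAlg [LocallyCompactSpace X] (K : Set S.U) (n : ℕ) : NonUnitalStarSubalgebra ℂ A where
  carrier := {b | π.Core K n b}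
  add_mem' := .add n _ _
  zero_mem' := Core.zero π K n
  mul_mem' := Core.mul
  smul_mem' c _ h := h.smul c
  star_mem' h := h.star

variable [LocallyCompactSpace X]

/-- Multiplication by `h` cuts `ξ` down to `W`, where `h ξ = (g ∘ σ) ζ` with `g = ⟨ζ, h ξ⟩`.
Localization on the left at `W` thereby becomes localization one layer deeper, at `σ(W)`. -/
theorem exists_t0_mul_t1_factor {W : Set S.U} (hW : IsOpen W) (hi : Set.InjOn S.σ W)
    {h : C₀(X, ℂ)} (hh : tsupport h ⊆ Subtype.val '' W) (ξ : C_c(S.U, ℂ)) :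
    ∃ (ζ : C_c(S.U, ℂ)) (g : C₀(X, ℂ)), tsupport ζ ⊆ W ∧
      tsupport g ⊆ S.σ '' W ∧ π.t0 h * π.t1 ξ = π.t1 ζ * π.t0 g := by
  have : LocallyCompactSpace S.U := S.U.isOpen.locallyCompactSpace
  have hsub : tsupport (S.resU h • ξ) ⊆ W := by
    have h1 : tsupport (S.resU h • ξ) ⊆ Subtype.val ⁻¹' tsupport h := by
      refine closure_minimal (fun y hy => ?_) ((isClosed_tsupport _).preimage continuous_subtype_val)
      by_contra hyn
      refine hy (show h y * ξ y = 0 from ?_)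
      rw [image_eq_zero_of_notMem_tsupport hyn, zero_mul]
    intro y hy
    obtain ⟨z, hz, hzy⟩ := hh (h1 hy)
    rwa [← Subtype.ext hzy]
  obtain ⟨ζ, hζW, hζ⟩ := exists_cutoff (S.resU h • ξ).hasCompactSupport.isCompact hW hsub
  have hc : IsCompact (S.σ '' tsupport ζ) :=
    ζ.hasCompactSupport.isCompact.image S.isLocalHomeomorph.continuous
  have hsup : tsupport (S.ip ζ (S.resU h • ξ)) ⊆ S.σ '' tsupport ζ := by
    refine closure_minimal (fun x hx => ?_) hc.isClosed
    by_contra hxn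
    exact hx (S.ip_eq_zero_of_notMem_image hxn)
  refine ⟨ζ, S.ip ζ (S.resU h • ξ), hζW,
    hsup.trans (Set.image_mono hζW), ?_⟩
  rw [π.t0_mul_t1, π.t1_mul_t0, S.eq_pull_ip_smul hi hζW hζ]

/-- Elements of a stage of the core are locally diagonal. -/
theorem Core.exists_open_mem_range {K : Set S.U} (hK : IsCompact K) (n : ℕ) (x : X) :
    ∃ V : Set X, IsOpen V ∧ x ∈ V ∧ ∀ b, π.Core K n b → ∀ h h' : C₀(X, ℂ),
      tsupport h ⊆ V → tsupport h' ⊆ V → π.t0 h * b * π.t0 h' ∈ Set.range π.t0 := by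
  have hadd : ∀ a b, a ∈ Set.range π.t0 → b ∈ Set.range π.t0 → a + b ∈ Set.range π.t0 := by
    rintro _ _ ⟨f, rfl⟩ ⟨g, rfl⟩
    exact ⟨f + g, map_add _ _ _⟩
  induction n generalizing x with
  | zero =>
    refine ⟨Set.univ, isOpen_univ, trivial, fun b hb h h' _ _ => ?_⟩
    suffices H : ∀ m b, π.Core K m b → m = 0 → π.t0 h * b * π.t0 h' ∈ Set.range π.t0 from
      H 0 b hb rfl
    intro m b hb
    induction hb with
    | t0 n f => exact fun _ => ⟨h * f * h', by simp⟩
    | add n a b _ _ iha ihb =>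
      intro hm
      rw [mul_add, add_mul]
      exact hadd _ _ (iha hm) (ihb hm)
    | conj n ξ η b hξ hη hb _ => exact fun hm => absurd hm (Nat.succ_ne_zero n)
  | succ n ih =>
    suffices H : ∃ V : Set X, IsOpen V ∧ x ∈ V ∧ ∀ b, π.Core K n b → ∀ ξ η : C_c(S.U, ℂ),
        tsupport ξ ⊆ K → tsupport η ⊆ K → ∀ h h' : C₀(X, ℂ), tsupport h ⊆ V → tsupport h' ⊆ V →
          π.t0 h * (π.t1 ξ * b * Star.star (π.t1 η)) * π.t0 h' ∈ Set.range π.t0 by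
      obtain ⟨V, hV, hxV, H⟩ := H
      refine ⟨V, hV, hxV, fun b hb h h' hh hh' => ?_⟩
      suffices H' : ∀ m b, π.Core K m b → m = n + 1 →
          π.t0 h * b * π.t0 h' ∈ Set.range π.t0 from H' _ b hb rfl
      intro m b hb
      induction hb with
      | t0 n f => exact fun _ => ⟨h * f * h', by simp⟩
      | add n a b _ _ iha ihb =>
        intro hm
        rw [mul_add, add_mul]
        exact hadd _ _ (iha hm) (ihb hm)
      | conj m ξ η b hξ hη hbm _ =>
        intro hm
        obtain rfl : m = n := by omega
        exact H b hbm ξ η hξ hη h h' hh hh'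
    -- At `x = y ∈ K`, choose `W` with `σ` injective on it and `σ(W)` inside the neighbourhood of `σ
    -- y` given by the previous stage. The inner factor then becomes some `t0 f`, and (ii) turns `t1
    -- ζ (t0 f) (t1 ζ')*` into a function.
    by_cases hx : x ∈ Subtype.val '' K
    · obtain ⟨y, -, rfl⟩ := hx
      obtain ⟨W, hW, hyW, hi⟩ := S.exists_injOn_nhds y
      obtain ⟨V', hV', hyV', H⟩ := ih (S.σ y)
      have hWo : IsOpen (W ∩ S.σ ⁻¹' V') := hW.inter (hV'.preimage S.isLocalHomeomorph.continuous)
      have hWi : Set.InjOn S.σ (W ∩ S.σ ⁻¹' V') := hi.mono Set.inter_subset_left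
      have him : S.σ '' (W ∩ S.σ ⁻¹' V') ⊆ V' := by
        rintro _ ⟨z, hz, rfl⟩
        exact hz.2
      refine ⟨_, S.U.isOpen.isOpenMap_subtype_val _ hWo, ⟨y, ⟨hyW, hyV'⟩, rfl⟩,
        fun b hb ξ η _ _ h h' hh hh' => ?_⟩
      obtain ⟨ζ, g, hζ, hg, e⟩ := π.exists_t0_mul_t1_factor hWo hWi hh ξ
      obtain ⟨ζ', g', hζ', hg', e'⟩ := π.exists_t0_mul_t1_factor hWo hWi (h := Star.star h')
        (by rwa [tsupport_star_eq]) η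
      obtain ⟨f, hf⟩ := H b hb g (Star.star g') (hg.trans him)
        (by rw [tsupport_star_eq]; exact hg'.trans him)
      have e'' := congrArg Star.star e'
      rw [star_mul, star_mul, ← map_star π.t0, ← map_star π.t0, star_star] at e''
      refine ⟨S.extend ((S.pull f • ζ) * Star.star ζ'), ?_⟩
      rw [← π.t1_mul_star_t1 _ hWo hWi _ ζ' ((tsupport_smul_subset _ _).trans hζ) hζ',
        ← π.t1_mul_t0, hf]
      calc π.t1 ζ * (π.t0 g * b * π.t0 (Star.star g')) * Star.star (π.t1 ζ')
          = (π.t1 ζ * π.t0 g) * b * (π.t0 (Star.star g') * Star.star (π.t1 ζ')) := by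
            simp only [mul_assoc]
        _ = (π.t0 h * π.t1 ξ) * b * (Star.star (π.t1 η) * π.t0 h') := by rw [e, e'']
        _ = _ := by simp only [mul_assoc]
    -- Off `K` the compressed conjugates vanish. Fixing the compact set `K` in advance makes one
    -- neighbourhood valid for every element of the stage.
    · refine ⟨_, (hK.image continuous_subtype_val).isClosed.isOpen_compl, hx,
        fun b hb ξ η hξ _ h h' hh _ => ⟨0, ?_⟩⟩
      have h0 : S.resU h • ξ = 0 := by
        ext y
        change h y * ξ y = 0
        by_cases hy : y ∈ tsupport ξ
        · rw [image_eq_zero_of_notMem_tsupport fun hyh => hh hyh ⟨y, hξ hy, rfl⟩, zero_mul]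
        · rw [image_eq_zero_of_notMem_tsupport hy, mul_zero]
      rw [← mul_assoc, ← mul_assoc, π.t0_mul_t1, h0]
      simp

/-- The core: the union of all its stages. -/
def IsCore (b : A) : Prop := ∃ (K : Set S.U) (n : ℕ), IsCompact K ∧ π.Core K n b

end Rep

/-- A closed property of elements of `C⋆(S)` can be checked on generators. -/
theorem CStar.induction_on {p : S.CStar → Prop} (hcl : IsClosed {a | p a})
    (t0 : ∀ f, p (S.universal.t0 f)) (t1 : ∀ ξ, p (S.universal.t1 ξ))
    (add : ∀ a b, p a → p b → p (a + b)) (mul : ∀ a b, p a → p b → p (a * b))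
    (smul : ∀ (c : ℂ) a, p a → p (c • a)) (star : ∀ a, p a → p (star a)) (a : S.CStar) : p a := by
  have ha : a ∈ (NonUnitalStarAlgebra.adjoin ℂ
      (Set.range S.universal.t0 ∪ Set.range S.universal.t1)).topologicalClosure := by
    rw [adjoin_universal]
    exact NonUnitalStarAlgebra.mem_top
  refine closure_minimal (fun b hb => ?_) hcl ha
  refine NonUnitalStarAlgebra.adjoin_induction (R := ℂ) (p := fun y _ => p y) ?_
    (fun a b _ _ => add a b) ?_ (fun a b _ _ => mul a b) (fun c a _ => smul c a)
    (fun a _ => star a) hb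
  · rintro _ (⟨f, rfl⟩ | ⟨ξ, rfl⟩)
    · exact t0 f
    · exact t1 ξ
  · rw [← map_zero S.universal.t0]
    exact t0 0

/-! ### Comparing ideals on the core -/

section Ideals

variable [LocallyCompactSpace X] {I I' : TwoSidedIdeal S.CStar}

/-- By nondegeneracy of `C₀(X)`, the hypothesis spreads to `b * a ∈ I` for all `a`, in particular
for `a = star b`. -/
theorem mem_of_forall_mul_t0_mem (hI : IsClosed (I : Set S.CStar)) {b : S.CStar}
    (h : ∀ f, b * S.universal.t0 f ∈ I) : b ∈ I := by
  -- The adjoint is carried along so that the induction passes through `star`.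
  have key : ∀ a, b * a ∈ I ∧ b * star a ∈ I := by
    refine CStar.induction_on ?_ ?_ ?_ ?_ ?_ ?_ ?_
    · exact (hI.preimage (by fun_prop : Continuous fun a => b * a)).inter
        (hI.preimage (by fun_prop : Continuous fun a => b * star a))
    · exact fun f => ⟨h f, by rw [← map_star]; exact h _⟩
    · intro ξ
      constructor
      · obtain ⟨f, hf⟩ := S.universal.exists_t0_mul_t1_eq ξ
        rw [hf, ← mul_assoc]
        exact I.mul_mem_right _ _ (h f)
      · obtain ⟨f, hf⟩ := S.universal.exists_t1_mul_t0_eq ξ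
        rw [hf, star_mul, ← map_star, ← mul_assoc]
        exact I.mul_mem_right _ _ (h _)
    · intro a c ha hc
      rw [star_add, mul_add, mul_add]
      exact ⟨I.add_mem ha.1 hc.1, I.add_mem ha.2 hc.2⟩
    · intro a c ha hc
      rw [star_mul, ← mul_assoc, ← mul_assoc]
      exact ⟨I.mul_mem_right _ _ ha.1, I.mul_mem_right _ _ hc.2⟩
    · intro c a ha
      rw [star_smul, mul_smul_comm, mul_smul_comm]
      exact ⟨I.smul_mem_of_isClosed hI _ ha.1, I.smul_mem_of_isClosed hI _ ha.2⟩
    · intro a ha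
      rw [star_star]
      exact ha.symm
  have h1 : star b ∈ I := I.mem_of_star_mul_self_mem hI (by rw [star_star]; exact (key b).2)
  simpa using I.star_mem_of_isClosed hI h1

theorem mem_of_mem_closure_coreAlg (hI' : IsClosed (I' : Set S.CStar))
    (h : ∀ f, S.universal.t0 f ∈ I → S.universal.t0 f ∈ I') {K : Set S.U} (hK : IsCompact K) {n : ℕ} {b : S.CStar}
    (hb : b ∈ (S.universal.coreAlg K n).topologicalClosure) (hbI : b ∈ I) : b ∈ I' := by
  refine mem_of_forall_mul_t0_mem hI' fun f => ?_
  suffices H : f ∈ {f | b * S.universal.t0 f ∈ I'} from H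
  refine ZeroAtInftyContinuousMap.mem_of_isClosed_ideal ?_ ?_ ?_ ?_ ?_
  · exact hI'.preimage (continuous_const.mul
      (AddMonoidHomClass.continuous_of_bound S.universal.t0 1 fun f => by
        simpa using S.universal.norm_t0_le f))
  · change b * S.universal.t0 0 ∈ I'
    rw [map_zero, mul_zero]
    exact I'.zero_mem
  · intro f hf g hg
    change b * S.universal.t0 (f + g) ∈ I'
    rw [map_add, mul_add]
    exact I'.add_mem hf hg
  · intro f g hg
    change b * S.universal.t0 (f * g) ∈ I'
    rw [mul_comm, map_mul, ← mul_assoc]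
    exact I'.mul_mem_right _ _ hg
  -- The ideal of those `f` with `b * t0 f ∈ I'` has no common zero: it contains a `k` with `k x =
  -- 1`.
  · intro x hx
    exfalso
    obtain ⟨V, hV, hxV, H⟩ := Rep.Core.exists_open_mem_range S.universal hK n x
    obtain ⟨k, hk1, hkV⟩ := ZeroAtInftyContinuousMap.exists_ne_zero_of_notMem
      hV.isClosed_compl (x := x) (by simpa using hxV)
    rw [compl_compl] at hkV
    have h1 : ∀ c ∈ (S.universal.coreAlg K n).topologicalClosure,
        S.universal.t0 (star k) * c * S.universal.t0 k ∈ Set.range S.universal.t0 := by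
      intro c hc
      refine closure_minimal (fun c hc => ?_) (S.isClosed_range_universal_t0.preimage
        (by fun_prop : Continuous fun c => S.universal.t0 (star k) * c * S.universal.t0 k)) hc
      exact H c hc (star k) k (by rwa [tsupport_star_eq]) hkV
    -- The square `k̄ b* b k` lies in `I` and, by local diagonality, in the range of `t0`, where the
    -- hypothesis on `I` and `I'` applies.
    have h2 : b * S.universal.t0 k ∈ I' := by
      refine I'.mem_of_star_mul_self_mem hI' ?_
      have e : star (b * S.universal.t0 k) * (b * S.universal.t0 k) =
          S.universal.t0 (star k) * (star b * b) * S.universal.t0 k := by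
        rw [star_mul, map_star]
        simp only [mul_assoc]
      obtain ⟨f, hf⟩ := h1 _ (mul_mem (star_mem hb) hb)
      rw [e, ← hf]
      refine h f ?_
      rw [hf]
      exact I.mul_mem_right _ _ (I.mul_mem_left _ _ (I.mul_mem_left _ _ hbI))
    have := hx k h2
    rw [hk1] at this
    exact one_ne_zero this

/-- The intersection of an ideal with a closure need not be approximated from the stages directly.
Instead, on each closed stage the kernel inclusion gives `‖b + I'‖ ≤ ‖b + I‖`, and this is at most
`‖x - b‖` because `x ∈ I`. -/
theorem mem_of_mem_closure_isCore (hI : IsClosed (I : Set S.CStar))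
    (hI' : IsClosed (I' : Set S.CStar))
    (h : ∀ f, S.universal.t0 f ∈ I → S.universal.t0 f ∈ I') {x : S.CStar} (hx : x ∈ closure {b | S.universal.IsCore b})
    (hxI : x ∈ I) : x ∈ I' := by
  rw [← TwoSidedIdeal.CStarQuotient.mk_eq_zero hI', ← norm_eq_zero]
  refine le_antisymm (le_of_forall_pos_le_add fun ε hε => ?_) (norm_nonneg _)
  obtain ⟨b, ⟨K, n, hK, hb⟩, hxb⟩ := Metric.mem_closure_iff.1 hx (ε / 2) (half_pos hε)
  rw [dist_eq_norm] at hxb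
  set C := (S.universal.coreAlg K n).topologicalClosure with hC
  let _ : NonUnitalCStarAlgebra C := NonUnitalStarSubalgebra.nonUnitalCStarAlgebra C
    (h_closed := NonUnitalStarSubalgebra.isClosed_topologicalClosure _)
  have hbC : b ∈ C := NonUnitalStarSubalgebra.le_topologicalClosure _ hb
  have h1 : ‖TwoSidedIdeal.CStarQuotient.mk hI' b‖ ≤ ‖TwoSidedIdeal.CStarQuotient.mk hI b‖ :=
    NonUnitalStarAlgHom.norm_apply_le_of_ker_le
      ((TwoSidedIdeal.CStarQuotient.mk hI).comp (NonUnitalStarSubalgebraClass.subtype C))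
      ((TwoSidedIdeal.CStarQuotient.mk hI').comp (NonUnitalStarSubalgebraClass.subtype C))
      (fun c hc => (TwoSidedIdeal.CStarQuotient.mk_eq_zero hI').2
        (mem_of_mem_closure_coreAlg hI' h hK c.2
          ((TwoSidedIdeal.CStarQuotient.mk_eq_zero hI).1 hc))) ⟨b, hbC⟩
  have h2 : ‖TwoSidedIdeal.CStarQuotient.mk hI b‖ ≤ ‖x - b‖ := by
    have e : TwoSidedIdeal.CStarQuotient.mk hI b = - TwoSidedIdeal.CStarQuotient.mk hI (x - b) := by
      rw [map_sub, (TwoSidedIdeal.CStarQuotient.mk_eq_zero hI).2 hxI, zero_sub, neg_neg]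
    rw [e, norm_neg]
    exact NonUnitalStarAlgHom.norm_apply_le _ _
  have h3 : ‖TwoSidedIdeal.CStarQuotient.mk hI' x‖ ≤
      ‖x - b‖ + ‖TwoSidedIdeal.CStarQuotient.mk hI' b‖ := by
    have e : TwoSidedIdeal.CStarQuotient.mk hI' x = TwoSidedIdeal.CStarQuotient.mk hI' (x - b) +
        TwoSidedIdeal.CStarQuotient.mk hI' b := by rw [map_sub, sub_add_cancel]
    rw [e]
    refine (norm_add_le _ _).trans ?_
    gcongr
    exact NonUnitalStarAlgHom.norm_apply_le _ _
  linarith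

end Ideals

end SGDS

/-! ### Homogeneous elements for the gauge grading -/

namespace SGDS

variable {X : Type u} [TopologicalSpace X] [T2Space X] {S : SGDS X}

namespace Rep

variable {A : Type w} [NonUnitalCStarAlgebra A] {π : S.Rep A}

namespace IsCore

variable {a b : A}

theorem t0 (π : S.Rep A) (f : C₀(X, ℂ)) : π.IsCore (π.t0 f) := ⟨∅, 0, isCompact_empty, .t0 0 f⟩

theorem exists_common (ha : π.IsCore a) (hb : π.IsCore b) :
    ∃ (K : Set S.U) (n : ℕ), IsCompact K ∧ π.Core K n a ∧ π.Core K n b := by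
  obtain ⟨K, n, hK, ha⟩ := ha
  obtain ⟨L, m, hL, hb⟩ := hb
  exact ⟨K ∪ L, max n m, hK.union hL,
    (ha.mono_left Set.subset_union_left).mono_right (le_max_left n m),
    (hb.mono_left Set.subset_union_right).mono_right (le_max_right n m)⟩

theorem add (ha : π.IsCore a) (hb : π.IsCore b) : π.IsCore (a + b) := by
  obtain ⟨K, n, hK, ha, hb⟩ := ha.exists_common hb
  exact ⟨K, n, hK, .add n a b ha hb⟩

theorem mul [LocallyCompactSpace X] (ha : π.IsCore a) (hb : π.IsCore b) : π.IsCore (a * b) := by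
  obtain ⟨K, n, hK, ha, hb⟩ := ha.exists_common hb
  exact ⟨K, n, hK, ha.mul hb⟩

theorem smul (c : ℂ) (ha : π.IsCore a) : π.IsCore (c • a) := by
  obtain ⟨K, n, hK, ha⟩ := ha
  exact ⟨K, n, hK, ha.smul c⟩

theorem star (ha : π.IsCore a) : π.IsCore (star a) := by
  obtain ⟨K, n, hK, ha⟩ := ha
  exact ⟨K, n, hK, ha.star⟩

theorem conj (ξ η : C_c(S.U, ℂ)) (hb : π.IsCore b) :
    π.IsCore (π.t1 ξ * b * Star.star (π.t1 η)) := by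
  obtain ⟨K, n, hK, hb⟩ := hb
  exact ⟨K ∪ (tsupport ξ ∪ tsupport η), n + 1,
    hK.union (ξ.hasCompactSupport.isCompact.union η.hasCompactSupport.isCompact),
    .conj n ξ η b (Set.subset_union_left.trans Set.subset_union_right)
      (Set.subset_union_right.trans Set.subset_union_right) (hb.mono_left Set.subset_union_left)⟩

end IsCore

/-- The homogeneous elements of degree `m ≥ 0`: sums of products of `m` elements of the form `t1 ξ`
and an element of the core. -/
inductive Pos (π : S.Rep A) : ℕ → A → Prop
  | of (b : A) : π.IsCore b → Pos π 0 b
  | add (m : ℕ) (a b : A) : Pos π m a → Pos π m b → Pos π m (a + b)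
  | mul (m : ℕ) (ξ : C_c(S.U, ℂ)) (b : A) : Pos π m b → Pos π (m + 1) (π.t1 ξ * b)

namespace Pos

variable {m : ℕ} {a b : A}

theorem isCore (hb : π.Pos 0 b) : π.IsCore b := by
  suffices H : ∀ m b, π.Pos m b → m = 0 → π.IsCore b from H 0 b hb rfl
  intro m b hb
  induction hb with
  | of b h => exact fun _ => h
  | add m a b _ _ iha ihb => exact fun hm => (iha hm).add (ihb hm)
  | mul m ξ b _ _ => exact fun hm => absurd hm (Nat.succ_ne_zero m)

theorem succ_induction {p : A → Prop} (hadd : ∀ a b, p a → p b → p (a + b))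
    (hmul : ∀ ξ b, π.Pos m b → p (π.t1 ξ * b)) (hb : π.Pos (m + 1) b) : p b := by
  suffices H : ∀ n b, π.Pos n b → n = m + 1 → p b from H _ b hb rfl
  intro n b hb
  induction hb with
  | of b h => exact fun hm => absurd hm.symm (Nat.succ_ne_zero m)
  | add n a b _ _ iha ihb => exact fun hm => hadd _ _ (iha hm) (ihb hm)
  | mul n ξ b hb' _ =>
    intro hm
    obtain rfl : n = m := by omega
    exact hmul ξ b hb'

theorem smul (c : ℂ) (hb : π.Pos m b) : π.Pos m (c • b) := by
  induction hb with
  | of b h => exact .of _ (h.smul c)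
  | add m a b _ _ iha ihb => rw [smul_add]; exact .add m _ _ iha ihb
  | mul m ξ b _ ih => rw [← mul_smul_comm]; exact .mul m ξ _ ih

theorem mul_star_t1 (η : C_c(S.U, ℂ)) (hb : π.Pos (m + 1) b) :
    π.Pos m (b * star (π.t1 η)) := by
  induction m generalizing b with
  | zero =>
    refine succ_induction (p := fun b => π.Pos 0 (b * star (π.t1 η))) ?_ ?_ hb
    · intro a b ha hb
      rw [add_mul]
      exact .add _ _ _ ha hb
    · intro ξ b hb
      exact .of _ (hb.isCore.conj ξ η)
  | succ m ih =>
    refine succ_induction (p := fun b => π.Pos (m + 1) (b * star (π.t1 η))) ?_ ?_ hb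
    · intro a b ha hb
      rw [add_mul]
      exact .add _ _ _ ha hb
    · intro ξ b hb
      rw [mul_assoc]
      exact .mul _ _ _ (ih hb)

variable [LocallyCompactSpace X]

theorem mul_t0 (f : C₀(X, ℂ)) (hb : π.Pos m b) : π.Pos m (b * π.t0 f) := by
  induction hb with
  | of b h => exact .of _ (h.mul (.t0 π f))
  | add m a b _ _ iha ihb => rw [add_mul]; exact .add m _ _ iha ihb
  | mul m ξ b _ ih => rw [mul_assoc]; exact .mul m ξ _ ih

theorem t0_mul (f : C₀(X, ℂ)) (hb : π.Pos m b) : π.Pos m (π.t0 f * b) := by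
  induction hb with
  | of b h => exact .of _ ((IsCore.t0 π f).mul h)
  | add m a b _ _ iha ihb => rw [mul_add]; exact .add m _ _ iha ihb
  | mul m ξ b hb _ => rw [← mul_assoc, π.t0_mul_t1]; exact .mul m _ _ hb

/-- The factor from the core that `Pos` requires on the right is supplied by nondegeneracy. -/
theorem t1 (η : C_c(S.U, ℂ)) : π.Pos 1 (π.t1 η) := by
  obtain ⟨f, hf⟩ := π.exists_t1_mul_t0_eq η
  rw [hf]
  exact .mul 0 η _ (.of _ (.t0 π f))

theorem mul_t1 (η : C_c(S.U, ℂ)) (hb : π.Pos m b) : π.Pos (m + 1) (b * π.t1 η) := by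
  induction hb with
  | of b h =>
    obtain ⟨K, n, hK, h⟩ := h
    suffices H : π.Pos (0 + 1) (b * π.t1 η) from H
    induction h with
    | t0 n f => exact (Pos.t1 η).t0_mul f
    | add n a b _ _ iha ihb => rw [add_mul]; exact .add _ _ _ iha ihb
    | conj n ξ ζ b hξ hζ hb _ =>
      rw [mul_assoc, π.star_t1_mul_t1, mul_assoc]
      exact .mul 0 ξ _ (.of _ ⟨K, n, hK, hb.mul_t0 _⟩)
  | add m a b _ _ iha ihb => rw [add_mul]; exact .add _ _ _ iha ihb
  | mul m ξ b _ ih => rw [mul_assoc]; exact .mul _ _ _ ih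

theorem star_t1_mul (η : C_c(S.U, ℂ)) (hb : π.Pos (m + 1) b) :
    π.Pos m (star (π.t1 η) * b) := by
  refine succ_induction (p := fun b => π.Pos m (star (π.t1 η) * b)) ?_ ?_ hb
  · intro a b ha hb
    rw [mul_add]
    exact .add _ _ _ ha hb
  · intro ξ b hb
    rw [← mul_assoc, π.star_t1_mul_t1]
    exact hb.t0_mul _

end Pos

/-- Sums of homogeneous elements. -/
inductive Graded (π : S.Rep A) : A → Prop
  | pos (m : ℕ) (b : A) : π.Pos m b → Graded π b
  | neg (m : ℕ) (b : A) : π.Pos m b → Graded π (star b)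
  | add (a b : A) : Graded π a → Graded π b → Graded π (a + b)

namespace Graded

variable {a b : A}

theorem smul (c : ℂ) (hb : π.Graded b) : π.Graded (c • b) := by
  induction hb with
  | pos m b h => exact .pos m _ (h.smul c)
  | neg m b h =>
    have e : c • Star.star b = Star.star (Star.star c • b) := by rw [star_smul, star_star]
    rw [e]
    exact .neg m _ (h.smul _)
  | add a b _ _ iha ihb => rw [smul_add]; exact .add _ _ iha ihb

theorem star (hb : π.Graded b) : π.Graded (star b) := by
  induction hb with
  | pos m b h => exact .neg m _ h
  | neg m b h => rw [star_star]; exact .pos m _ h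
  | add a b _ _ iha ihb => rw [star_add]; exact .add _ _ iha ihb

theorem t1_mul (ξ : C_c(S.U, ℂ)) (hb : π.Graded b) : π.Graded (π.t1 ξ * b) := by
  induction hb with
  | pos m b h => exact .pos _ _ (.mul m ξ b h)
  | neg m b h =>
    cases m with
    | zero => exact .pos _ _ (.mul 0 ξ _ (.of _ h.isCore.star))
    | succ m =>
      have e : π.t1 ξ * Star.star b = Star.star (b * Star.star (π.t1 ξ)) := by
        rw [star_mul, star_star]
      rw [e]
      exact .neg m _ (h.mul_star_t1 ξ)
  | add a b _ _ iha ihb => rw [mul_add]; exact .add _ _ iha ihb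

variable [LocallyCompactSpace X]

theorem t0_mul (f : C₀(X, ℂ)) (hb : π.Graded b) : π.Graded (π.t0 f * b) := by
  induction hb with
  | pos m b h => exact .pos m _ (h.t0_mul f)
  | neg m b h =>
    have e : π.t0 f * Star.star b = Star.star (b * π.t0 (Star.star f)) := by
      rw [star_mul, ← map_star, star_star]
    rw [e]
    exact .neg m _ (h.mul_t0 _)
  | add a b _ _ iha ihb => rw [mul_add]; exact .add _ _ iha ihb

theorem star_t1_mul (ξ : C_c(S.U, ℂ)) (hb : π.Graded b) :
    π.Graded (Star.star (π.t1 ξ) * b) := by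
  induction hb with
  | pos m b h =>
    cases m with
    | zero =>
      have e : Star.star (π.t1 ξ) * b = Star.star (Star.star b * π.t1 ξ) := by
        rw [star_mul, star_star]
      rw [e]
      exact .neg _ _ ((Pos.of _ h.isCore.star).mul_t1 ξ)
    | succ m => exact .pos m _ (h.star_t1_mul ξ)
  | neg m b h =>
    rw [← star_mul]
    exact .neg _ _ (h.mul_t1 ξ)
  | add a b _ _ iha ihb => rw [mul_add]; exact .add _ _ iha ihb

end Graded

end Rep

theorem dense_graded [LocallyCompactSpace X] : Dense {b | S.universal.Graded b} := by
  intro a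
  have ha : a ∈ (NonUnitalStarAlgebra.adjoin ℂ
      (Set.range S.universal.t0 ∪ Set.range S.universal.t1)).topologicalClosure := by
    rw [adjoin_universal]
    exact NonUnitalStarAlgebra.mem_top
  refine closure_mono (fun b hb => ?_) ha
  -- It is easier to show that generators and their adjoints multiply `Graded` into itself than to
  -- treat products of two homogeneous elements. The strengthened statement is stable under all
  -- algebra operations.
  suffices H : S.universal.Graded b ∧ ∀ c, S.universal.Graded c →
      S.universal.Graded (b * c) ∧ S.universal.Graded (star b * c) from H.1
  have h0 : ∀ f, S.universal.Graded (S.universal.t0 f) := fun f => .pos 0 _ (.of _ (.t0 _ f))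
  refine NonUnitalStarAlgebra.adjoin_induction (R := ℂ) (p := fun b _ => S.universal.Graded b ∧
      ∀ c, S.universal.Graded c → S.universal.Graded (b * c) ∧ S.universal.Graded (star b * c))
    ?_ ?_ ?_ ?_ ?_ ?_ hb
  · rintro _ (⟨f, rfl⟩ | ⟨ξ, rfl⟩)
    · exact ⟨h0 f, fun c hc => ⟨hc.t0_mul f, by rw [← map_star]; exact hc.t0_mul _⟩⟩
    · exact ⟨.pos 1 _ (.t1 ξ), fun c hc => ⟨hc.t1_mul ξ, hc.star_t1_mul ξ⟩⟩
  · rintro a b - - ⟨ha, ha'⟩ ⟨hb, hb'⟩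
    refine ⟨.add _ _ ha hb, fun c hc => ?_⟩
    rw [star_add, add_mul, add_mul]
    exact ⟨.add _ _ (ha' c hc).1 (hb' c hc).1, .add _ _ (ha' c hc).2 (hb' c hc).2⟩
  · have h00 : S.universal.Graded 0 := by
      rw [← map_zero S.universal.t0]
      exact h0 0
    exact ⟨h00, fun c _ => by rw [star_zero, zero_mul]; exact ⟨h00, h00⟩⟩
  · rintro a b - - ⟨ha, ha'⟩ ⟨hb, hb'⟩
    refine ⟨(ha' b hb).1, fun c hc => ?_⟩
    rw [star_mul, mul_assoc, mul_assoc]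
    exact ⟨(ha' _ (hb' c hc).1).1, (hb' _ (ha' c hc).2).2⟩
  · rintro r a - ⟨ha, ha'⟩
    refine ⟨ha.smul r, fun c hc => ?_⟩
    rw [star_smul, smul_mul_assoc, smul_mul_assoc]
    exact ⟨(ha' c hc).1.smul _, (ha' c hc).2.smul _⟩
  · rintro a - ⟨ha, ha'⟩
    refine ⟨ha.star, fun c hc => ?_⟩
    rw [star_star]
    exact (ha' c hc).symm

end SGDS

/-! ### Fourier analysis of the gauge action -/

namespace SGDS

open MeasureTheory

variable {X : Type u} [TopologicalSpace X] [T2Space X] {S : SGDS X}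

theorem CStar.hom_ext {A : Type w} [NonUnitalCStarAlgebra A] {φ ψ : S.CStar →⋆ₙₐ[ℂ] A}
    (h0 : ∀ f, φ (S.universal.t0 f) = ψ (S.universal.t0 f))
    (h1 : ∀ ξ, φ (S.universal.t1 ξ) = ψ (S.universal.t1 ξ)) : φ = ψ := by
  refine DFunLike.ext _ _ (CStar.induction_on ?_ h0 h1 ?_ ?_ ?_ ?_)
  · exact isClosed_eq φ.continuous' ψ.continuous'
  · exact fun a b ha hb => by rw [map_add, map_add, ha, hb]
  · exact fun a b ha hb => by rw [map_mul, map_mul, ha, hb]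
  · exact fun c a ha => by rw [map_smul, map_smul, ha]
  · exact fun a ha => by rw [map_star, map_star, ha]

theorem gauge_t0 (z : Circle) (f : C₀(X, ℂ)) :
    S.gauge z (S.universal.t0 f) = S.universal.t0 f := lift_t0 (S.gaugeRep z) f

theorem gauge_t1 (z : Circle) (ξ : C_c(S.U, ℂ)) :
    S.gauge z (S.universal.t1 ξ) = (z : ℂ) • S.universal.t1 ξ := lift_t1 (S.gaugeRep z) ξ

theorem gauge_one (a : S.CStar) : S.gauge 1 a = a := by
  have h : S.gauge 1 = NonUnitalStarAlgHom.id ℂ S.CStar :=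
    CStar.hom_ext (fun f => gauge_t0 1 f) fun ξ => by rw [gauge_t1]; simp
  rw [h]
  rfl

theorem gauge_gauge (z w : Circle) (a : S.CStar) :
    S.gauge z (S.gauge w a) = S.gauge (z * w) a := by
  have h : (S.gauge z).comp (S.gauge w) = S.gauge (z * w) :=
    CStar.hom_ext (fun f => by
      rw [NonUnitalStarAlgHom.comp_apply, gauge_t0, gauge_t0, gauge_t0]) fun ξ => by
      rw [NonUnitalStarAlgHom.comp_apply, gauge_t1, map_smul, gauge_t1, gauge_t1, smul_smul,
        Circle.coe_mul, mul_comm]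
  exact DFunLike.congr_fun h a

theorem gauge_pos (z : Circle) {m : ℕ} {b : S.CStar} (hb : S.universal.Pos m b) :
    S.gauge z b = (z : ℂ) ^ m • b := by
  have hz : star (z : ℂ) * z = 1 := by
    simp [← Complex.normSq_eq_conj_mul_self]
  induction hb with
  | of b h =>
    obtain ⟨K, n, -, h⟩ := h
    rw [pow_zero, one_smul]
    induction h with
    | t0 n f => exact gauge_t0 z f
    | add n a b _ _ iha ihb => rw [map_add, iha, ihb]
    | conj n ξ η b _ _ _ ih =>
      rw [map_mul, map_mul, map_star, ih, gauge_t1, gauge_t1, star_smul, smul_mul_assoc,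
        smul_mul_smul_comm, mul_comm, hz, one_smul]
  | add m a b _ _ iha ihb => rw [map_add, iha, ihb, smul_add]
  | mul m ξ b _ ih => rw [map_mul, ih, gauge_t1, smul_mul_smul_comm, pow_succ, mul_comm]

theorem norm_gauge_le (z : Circle) (a : S.CStar) : ‖S.gauge z a‖ ≤ ‖a‖ :=
  NonUnitalStarAlgHom.norm_apply_le _ _

/-- The gauge maps are contractive, so a limit of elements with continuous orbits has an orbit that
is a uniform limit. -/
theorem continuous_gauge (a : S.CStar) : Continuous fun z => S.gauge z a := by
  refine CStar.induction_on (p := fun a => Continuous fun z => S.gauge z a) ?_ ?_ ?_ ?_ ?_ ?_ ?_ a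
  · refine isClosed_of_closure_subset fun a ha => ?_
    refine continuous_of_uniform_approx_of_continuous fun u hu => ?_
    obtain ⟨ε, hε, hu⟩ := Metric.mem_uniformity_dist.1 hu
    obtain ⟨b, hb, hab⟩ := Metric.mem_closure_iff.1 ha ε hε
    refine ⟨_, hb, fun z => hu ?_⟩
    rw [dist_eq_norm] at hab ⊢
    rw [← map_sub]
    exact (norm_gauge_le z _).trans_lt hab
  · intro f
    simp only [gauge_t0]
    exact continuous_const
  · intro ξ
    simp only [gauge_t1]
    fun_prop
  · intro a b ha hb
    simp only [map_add]
    exact ha.add hb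
  · intro a b ha hb
    simp only [map_mul]
    exact ha.mul hb
  · intro c a ha
    simp only [map_smul]
    exact ha.const_smul c
  · intro a ha
    simp only [map_star]
    exact ha.star

/-- The rotation of the gauge action by `t ∈ ℝ/ℤ`. -/
noncomputable def rot (t : UnitAddCircle) (a : S.CStar) : S.CStar := S.gauge t.toCircle a

theorem continuous_rot (a : S.CStar) : Continuous fun t => rot t a :=
  (continuous_gauge a).comp AddCircle.continuous_toCircle

theorem integrable_smul_rot {f : UnitAddCircle → ℂ} (hf : Continuous f) (a : S.CStar) :
    Integrable (fun t => f t • rot t a) AddCircle.haarAddCircle :=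
  (hf.smul (continuous_rot a)).integrable_of_hasCompactSupport (HasCompactSupport.of_compactSpace _)

/-- The spectral component of degree `n` with respect to the gauge action. -/
noncomputable def component (n : ℤ) (a : S.CStar) : S.CStar :=
  fourierCoeff (fun t => rot t a) n

theorem component_eq (n : ℤ) (a : S.CStar) :
    component n a = ∫ t, fourier (-n) t • rot t a ∂AddCircle.haarAddCircle := rfl

theorem rot_component (s : UnitAddCircle) (n : ℤ) (a : S.CStar) :
    rot s (component n a) = fourier n s • component n a := by
  let L : S.CStar →L[ℂ] S.CStar := ⟨(S.gauge s.toCircle : S.CStar →ₗ[ℂ] S.CStar),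
    (S.gauge s.toCircle).continuous'⟩
  have h1 : rot s (component n a) =
      ∫ t, L (fourier (-n) t • rot t a) ∂AddCircle.haarAddCircle :=
    (L.integral_comp_comm (integrable_smul_rot (map_continuous _) a)).symm
  -- This puts the integrand in a form to which invariance of Haar measure under `t ↦ s + t`
  -- applies.
  have h2 : ∀ t, L (fourier (-n) t • rot t a) =
      fourier n s • (fourier (-n) (s + t) • rot (s + t) a) := by
    intro t
    have e1 : L (rot t a) = rot (s + t) a := by
      change S.gauge _ (S.gauge _ a) = S.gauge _ a
      rw [gauge_gauge, AddCircle.toCircle_add]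
    have e2 : (fourier n s : ℂ) * fourier (-n) (s + t) = fourier (-n) t := by
      simp only [fourier_apply, smul_add, neg_smul, AddCircle.toCircle_add, Circle.coe_mul]
      rw [← mul_assoc, ← Circle.coe_mul, ← AddCircle.toCircle_add, add_neg_cancel,
        AddCircle.toCircle_zero, Circle.coe_one, one_mul]
    rw [map_smul, e1, smul_smul, e2]
  rw [h1, integral_congr_ae (Filter.Eventually.of_forall h2), integral_smul,
    integral_add_left_eq_self (μ := AddCircle.haarAddCircle)
      (fun t : UnitAddCircle => (fourier (-n) t : ℂ) • rot t a) s]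
  rfl

theorem component_of_rot_eq {n : ℤ} {a : S.CStar} (h : ∀ t, rot t a = fourier n t • a) (m : ℤ) :
    component m a = if m = n then a else 0 := by
  have h1 : component m a = fourierCoeff (fourier n : UnitAddCircle → ℂ) m • a := by
    rw [component_eq, fourierCoeff, ← integral_smul_const]
    refine integral_congr_ae (Filter.Eventually.of_forall fun t => ?_)
    simp only [h t, smul_smul, smul_eq_mul]
  rw [h1, fourierCoeff_fourier, Pi.single_apply]
  split_ifs <;> simp

theorem component_add (n : ℤ) (a b : S.CStar) :
    component n (a + b) = component n a + component n b := by
  simp only [component_eq]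
  rw [← integral_add (integrable_smul_rot (map_continuous _) a)
    (integrable_smul_rot (map_continuous _) b)]
  refine integral_congr_ae (Filter.Eventually.of_forall fun t => ?_)
  simp only [rot, map_add, smul_add]

theorem norm_component_le (n : ℤ) (a : S.CStar) : ‖component n a‖ ≤ ‖a‖ := by
  rw [component_eq]
  refine (norm_integral_le_of_norm_le_const (C := ‖a‖)
    (Filter.Eventually.of_forall fun t => ?_)).trans (by simp)
  rw [norm_smul, fourier_apply, Circle.norm_coe, one_mul]
  exact norm_gauge_le _ _

theorem continuous_component (n : ℤ) : Continuous fun a : S.CStar => component n a := by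
  have h : ∀ a b : S.CStar, component n a - component n b = component n (a - b) := fun a b => by
    rw [sub_eq_iff_eq_add, ← component_add, sub_add_cancel]
  refine (LipschitzWith.of_dist_le_mul (K := 1) fun a b => ?_).continuous
  rw [dist_eq_norm, dist_eq_norm, h, NNReal.coe_one, one_mul]
  exact norm_component_le n _

/-- On the dense set of sums of homogeneous elements, `component 0` keeps the part of degree zero,
which belongs to the core; it is continuous. -/
theorem component_zero_mem [LocallyCompactSpace X] (a : S.CStar) :
    component 0 a ∈ closure {b | S.universal.IsCore b} := by
  have h0 : S.universal.IsCore 0 := by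
    rw [← map_zero S.universal.t0]
    exact .t0 _ 0
  have H : Set.MapsTo (component 0) {b | S.universal.Graded b} {b | S.universal.IsCore b} := by
    intro b hb
    change S.universal.IsCore (component 0 b)
    have hpow : ∀ (m : ℕ) (t : UnitAddCircle), (t.toCircle : ℂ) ^ m = fourier (m : ℤ) t := by
      intro m t
      rw [fourier_apply, natCast_zsmul, AddCircle.toCircle_nsmul, Circle.coe_pow]
    induction hb with
    | pos m b h =>
      rw [component_of_rot_eq (n := m) fun t => (gauge_pos _ h).trans (by rw [hpow])]
      split_ifs with hm
      · obtain rfl : m = 0 := by omega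
        exact h.isCore
      · exact h0
    | neg m b h =>
      rw [component_of_rot_eq (n := -m) fun t => by
        rw [rot, map_star, gauge_pos _ h, star_smul, hpow, fourier_neg, Complex.star_def]]
      split_ifs with hm
      · obtain rfl : m = 0 := by omega
        exact h.isCore.star
      · exact h0
    | add a b _ _ iha ihb =>
      rw [component_add]
      exact iha.add ihb
  exact map_mem_closure (continuous_component 0) (dense_graded a) H

/-! ### Gauge-invariant ideals are determined by their intersection with `t0(C₀(X))` -/

section Ideals

variable {I I' : TwoSidedIdeal S.CStar}

theorem component_mem (hI : IsClosed (I : Set S.CStar)) (hg : ∀ z, ∀ a ∈ I, S.gauge z a ∈ I)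
    {a : S.CStar} (ha : a ∈ I) (n : ℤ) : component n a ∈ I := by
  let q := TwoSidedIdeal.CStarQuotient.mk hI
  let L : S.CStar →L[ℂ] I.CStarQuotient hI :=
    ⟨(q : S.CStar →ₗ[ℂ] I.CStarQuotient hI), q.continuous'⟩
  rw [← TwoSidedIdeal.CStarQuotient.mk_eq_zero hI]
  have h1 : q (component n a) = ∫ t, L (fourier (-n) t • rot t a) ∂AddCircle.haarAddCircle :=
    (L.integral_comp_comm (integrable_smul_rot (map_continuous _) a)).symm
  refine h1.trans ((integral_congr_ae (Filter.Eventually.of_forall fun t => ?_)).trans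
    (integral_zero _ _))
  change q _ = 0
  have h2 : q (rot t a) = 0 := (TwoSidedIdeal.CStarQuotient.mk_eq_zero hI).2 (hg _ a ha)
  rw [map_smul, h2, smul_zero]

/-- By Hahn–Banach it suffices to apply functionals on the quotient. Each gives a continuous
function on the circle whose Fourier coefficients all vanish. -/
theorem mem_of_forall_component_mem (hI : IsClosed (I : Set S.CStar)) {a : S.CStar}
    (h : ∀ n, component n a ∈ I) : a ∈ I := by
  let q := TwoSidedIdeal.CStarQuotient.mk hI
  let L : S.CStar →L[ℂ] I.CStarQuotient hI :=
    ⟨(q : S.CStar →ₗ[ℂ] I.CStarQuotient hI), q.continuous'⟩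
  rw [← TwoSidedIdeal.CStarQuotient.mk_eq_zero hI]
  refine SeparatingDual.eq_zero_of_forall_dual_eq_zero (R := ℂ) fun φ => ?_
  let f : C(UnitAddCircle, ℂ) := ⟨fun t => (φ.comp L) (rot t a),
    (φ.comp L).continuous.comp (continuous_rot a)⟩
  have h0 : fourierCoeff f = 0 := by
    ext n
    have h1 : (φ.comp L) (component n a) =
        ∫ t, (φ.comp L) (fourier (-n) t • rot t a) ∂AddCircle.haarAddCircle :=
      ((φ.comp L).integral_comp_comm (integrable_smul_rot (map_continuous _) a)).symm
    simp only [map_smul] at h1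
    have h2 : (φ.comp L) (component n a) = 0 := by
      change φ (q (component n a)) = 0
      rw [(TwoSidedIdeal.CStarQuotient.mk_eq_zero hI).2 (h n), map_zero]
    exact h1.symm.trans h2
  -- The zero series is summable, so a continuous function with these coefficients equals its sum;
  -- at `0` its value is that of the functional on the class of `a`.
  have h1 := has_pointwise_sum_fourier_series_of_summable (f := f)
    (by rw [h0]; exact summable_zero) 0
  simp only [h0, Pi.zero_apply, zero_smul] at h1
  have h2 : f 0 = 0 := h1.unique hasSum_zero
  change φ (q (S.gauge (AddCircle.toCircle 0) a)) = 0 at h2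
  rwa [AddCircle.toCircle_zero, gauge_one] at h2

/-- A gauge-invariant closed ideal is contained in every closed ideal which contains its
intersection with `t0(C₀(X))`. -/
theorem le_of_gauge_invariant [LocallyCompactSpace X] (hI : IsClosed (I : Set S.CStar))
    (hg : ∀ z, ∀ a ∈ I, S.gauge z a ∈ I) (hI' : IsClosed (I' : Set S.CStar))
    (h : ∀ f, S.universal.t0 f ∈ I → S.universal.t0 f ∈ I') : I ≤ I' := by
  intro a ha
  refine mem_of_forall_component_mem hI' fun n => I'.mem_of_star_mul_self_mem hI' ?_
  -- The phases `zⁿ` and its conjugate cancel in `c`, so `c` is its own component of degree zero.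
  set c := star (component n a) * component n a with hc
  have hcI : c ∈ I := I.mul_mem_left _ _ (component_mem hI hg ha n)
  have hrot : ∀ t, rot t c = fourier 0 t • c := by
    intro t
    have h1 : rot t c = star (rot t (component n a)) * rot t (component n a) := by
      rw [hc, rot, map_mul, map_star]
      rfl
    have h2 : star (fourier n t : ℂ) * fourier n t = 1 := by
      rw [fourier_apply]
      simp [← Complex.normSq_eq_conj_mul_self]
    rw [h1, rot_component, star_smul, smul_mul_smul_comm, h2, fourier_zero]
  have h0 : component 0 c = c := by rw [component_of_rot_eq hrot, if_pos rfl]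
  refine mem_of_mem_closure_isCore hI hI' h ?_ hcI
  rw [← h0]
  exact component_zero_mem c

end Ideals

end SGDS

/-! ### The bijection between ideals and closed invariant sets -/

namespace SGDS

variable {X : Type u} [TopologicalSpace X] [T2Space X] {S : SGDS X}

/-- The common zeros of the functions `f` with `t0 f ∈ I`. -/
def zeroSet (I : TwoSidedIdeal S.CStar) : Set X := {x | ∀ f, S.universal.t0 f ∈ I → f x = 0}

theorem isClosed_zeroSet (I : TwoSidedIdeal S.CStar) : IsClosed (zeroSet I) := by
  simp only [zeroSet, Set.ofPred_forall]
  exact isClosed_iInter fun f => isClosed_iInter fun _ =>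
    isClosed_eq (map_continuous f) continuous_const

theorem isClosed_idealOf (Y : ClosedInvariant S) : IsClosed (idealOf Y : Set S.CStar) := by
  have h : (idealOf Y : Set S.CStar) = restrictHom Y ⁻¹' {0} := by
    ext a
    exact TwoSidedIdeal.mem_ker _
  rw [h]
  exact isClosed_singleton.preimage (restrictHom Y).continuous'

theorem gauge_restrictHom (Y : ClosedInvariant S) (z : Circle) (a : S.CStar) :
    (restrict Y).gauge z (restrictHom Y a) = restrictHom Y (S.gauge z a) := by
  have h : ((restrict Y).gauge z).comp (restrictHom Y) = (restrictHom Y).comp (S.gauge z) :=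
    CStar.hom_ext (fun f => by
      simp only [NonUnitalStarAlgHom.comp_apply, gauge_t0, restrictHom_t0]) fun ξ => by
      simp only [NonUnitalStarAlgHom.comp_apply, gauge_t1, restrictHom_t1, map_smul]
  exact DFunLike.congr_fun h a

theorem gauge_mem_idealOf (Y : ClosedInvariant S) (z : Circle) {a : S.CStar}
    (ha : a ∈ idealOf Y) : S.gauge z a ∈ idealOf Y := by
  rw [idealOf, TwoSidedIdeal.mem_ker] at *
  rw [← gauge_restrictHom, ha, map_zero]

theorem idealOf_mem_gaugeInvariantIdeals (Y : ClosedInvariant S) :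
    idealOf Y ∈ S.gaugeInvariantIdeals := by
  refine ⟨isClosed_idealOf Y, fun z => Set.Subset.antisymm ?_ fun a ha => ?_⟩
  · rintro _ ⟨a, ha, rfl⟩
    exact gauge_mem_idealOf Y z ha
  · refine ⟨S.gauge z⁻¹ a, gauge_mem_idealOf Y _ ha, ?_⟩
    rw [gauge_gauge, mul_inv_cancel, gauge_one]

variable [LocallyCompactSpace X]

theorem isSetOf_iff {I : TwoSidedIdeal S.CStar} {C : Set X} :
    S.IsSetOf I C ↔ ∀ f, S.universal.t0 f ∈ I ↔ ∀ x ∈ C, f x = 0 := by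
  constructor
  · intro h f
    constructor
    · intro hf
      have h1 : S.universal.t0 f ∈ S.universal.t0 '' {f : C₀(X, ℂ) | ∀ x ∈ C, f x = 0} := by
        rw [show _ = _ from h]
        exact ⟨⟨f, rfl⟩, hf⟩
      obtain ⟨g, hg, hgf⟩ := h1
      rwa [S.universal_t0_injective hgf] at hg
    · intro hf
      have h1 : S.universal.t0 f ∈ Set.range S.universal.t0 ∩ (I : Set S.CStar) := by
        rw [← show _ = _ from h]
        exact ⟨f, hf, rfl⟩
      exact h1.2
  · intro h
    refine Set.Subset.antisymm ?_ ?_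
    · rintro _ ⟨f, hf, rfl⟩
      exact ⟨⟨f, rfl⟩, (h f).2 hf⟩
    · rintro _ ⟨⟨f, rfl⟩, hf⟩
      exact ⟨f, (h f).1 hf, rfl⟩

theorem isSetOf_zeroSet {I : TwoSidedIdeal S.CStar} (hI : IsClosed (I : Set S.CStar)) :
    S.IsSetOf I (zeroSet I) := by
  refine isSetOf_iff.2 fun f => ⟨fun hf x hx => hx f hf, fun hf => ?_⟩
  suffices H : f ∈ {f | S.universal.t0 f ∈ I} from H
  refine ZeroAtInftyContinuousMap.mem_of_isClosed_ideal ?_ ?_ ?_ ?_ hf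
  · exact hI.preimage (AddMonoidHomClass.continuous_of_bound S.universal.t0 1 fun f => by
      simpa using S.universal.norm_t0_le f)
  · change S.universal.t0 0 ∈ I
    rw [map_zero]
    exact I.zero_mem
  · intro f hf g hg
    change S.universal.t0 (f + g) ∈ I
    rw [map_add]
    exact I.add_mem hf hg
  · intro f g hg
    change S.universal.t0 (f * g) ∈ I
    rw [map_mul]
    exact I.mul_mem_left _ _ hg

theorem IsSetOf.eq_zeroSet {I : TwoSidedIdeal S.CStar} {C : Set X} (hC : IsClosed C)
    (h : S.IsSetOf I C) : C = zeroSet I := by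
  refine Set.Subset.antisymm (fun x hx f hf => (isSetOf_iff.1 h f).1 hf x hx) fun x hx => ?_
  by_contra hxC
  obtain ⟨f, hf1, hf⟩ := ZeroAtInftyContinuousMap.exists_ne_zero_of_notMem hC hxC
  have h0 := hx f ((isSetOf_iff.1 h f).2 fun y hy =>
    image_eq_zero_of_notMem_tsupport fun hyf => hf hyf hy)
  exact one_ne_zero (hf1.symm.trans h0)

/-- With `ξ` a cutoff at `x` supported where `σ` is injective, `t1 ξ (t0 f) (t1 ξ)*` is a function
with value `f(σ x)` at `x`, and `(t1 ξ)* (t0 f) t1 ξ` is a function with value `f x` at `σ x`. Both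
remain in `I` when `t0 f` does. -/
theorem mem_zeroSet_iff (I : TwoSidedIdeal S.CStar) (x : S.U) :
    (x : X) ∈ zeroSet I ↔ S.σ x ∈ zeroSet I := by
  have : LocallyCompactSpace S.U := S.U.isOpen.locallyCompactSpace
  obtain ⟨V, hV, hxV, hi⟩ := S.exists_injOn_nhds x
  obtain ⟨ξ, hξV, hξ⟩ := exists_cutoff (isCompact_singleton (x := x)) hV (by simpa using hxV)
  have hξx : ξ x = 1 := hξ x rfl
  constructor
  · intro hx f hf
    have h1 : S.universal.t0 (S.extend ((S.pull f • ξ) * star ξ)) ∈ I := by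
      rw [← S.universal.t1_mul_star_t1 V hV hi _ ξ ((tsupport_smul_subset _ _).trans hξV) hξV,
        ← S.universal.t1_mul_t0]
      exact I.mul_mem_right _ _ (I.mul_mem_left _ _ hf)
    have h2 := hx _ h1
    rw [extend_apply] at h2
    have h3 : f (S.σ x) * ξ x * star (ξ x) = 0 := h2
    simpa [hξx] using h3
  · intro hx f hf
    have h1 : S.universal.t0 (S.ip ξ (S.resU f • ξ)) ∈ I := by
      rw [← S.universal.star_t1_mul_t1, ← S.universal.t0_mul_t1]
      exact I.mul_mem_left _ _ (I.mul_mem_right _ _ hf)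
    have h2 := hx _ h1
    rw [S.ip_apply_of_injOn hi hξV hxV] at h2
    have h3 : star (ξ x) * (f x * ξ x) = 0 := h2
    simpa [hξx] using h3

/-- On `t0(C₀(X))` the restriction map is restriction of functions followed by `t0` of the
restricted system, which is injective by its own representation on `ℓ²`. -/
theorem isSetOf_idealOf (Y : ClosedInvariant S) : S.IsSetOf (idealOf Y) Y.carrier := by
  have : LocallyCompactSpace Y.carrier := Y.isClosed.isClosedEmbedding_subtypeVal.locallyCompactSpace
  refine isSetOf_iff.2 fun f => ?_
  rw [idealOf, TwoSidedIdeal.mem_ker, restrictHom_t0,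
    map_eq_zero_iff _ (restrict Y).universal_t0_injective]
  constructor
  · exact fun h x hx => DFunLike.congr_fun h ⟨x, hx⟩
  · exact fun h => ZeroAtInftyContinuousMap.ext fun x => h x x.2

theorem eq_of_isSetOf {I I' : TwoSidedIdeal S.CStar} (hI : I ∈ S.gaugeInvariantIdeals)
    (hI' : I' ∈ S.gaugeInvariantIdeals) {C : Set X} (h : S.IsSetOf I C) (h' : S.IsSetOf I' C) :
    I = I' := by
  have H : ∀ {I I' : TwoSidedIdeal S.CStar}, I ∈ S.gaugeInvariantIdeals →
      I' ∈ S.gaugeInvariantIdeals → S.IsSetOf I C → S.IsSetOf I' C → I ≤ I' := by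
    intro I I' hI hI' h h'
    refine le_of_gauge_invariant hI.1 (fun z a ha => ?_) hI'.1 fun f hf =>
      (isSetOf_iff.1 h' f).2 ((isSetOf_iff.1 h f).1 hf)
    have h1 : S.gauge z a ∈ S.gauge z '' (I : Set S.CStar) := ⟨a, ha, rfl⟩
    rwa [hI.2 z] at h1
  exact le_antisymm (H hI hI' h h') (H hI' hI h' h)

end SGDS

theorem mainTheorem3 {X : Type u} [TopologicalSpace X] [T2Space X] [LocallyCompactSpace X]
    (S : SGDS X) :
    (∀ I : TwoSidedIdeal S.CStar, IsClosed (I : Set S.CStar) →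
      ∃! C : Set X, IsClosed C ∧ S.IsSetOf I C) ∧
    ∃ e : S.gaugeInvariantIdeals ≃ SGDS.ClosedInvariant S,
      (∀ I : S.gaugeInvariantIdeals, S.IsSetOf I.1 (e I).carrier) ∧
      ∀ Y : SGDS.ClosedInvariant S, (e.symm Y).1 = SGDS.idealOf Y := by
  refine ⟨fun I hI => ⟨SGDS.zeroSet I, ⟨SGDS.isClosed_zeroSet I, SGDS.isSetOf_zeroSet hI⟩,
    fun C hC => SGDS.IsSetOf.eq_zeroSet hC.1 hC.2⟩, ?_⟩
  let e : S.gaugeInvariantIdeals ≃ SGDS.ClosedInvariant S :=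
    { toFun I := ⟨SGDS.zeroSet I.1, SGDS.isClosed_zeroSet I.1, SGDS.mem_zeroSet_iff I.1⟩
      invFun Y := ⟨SGDS.idealOf Y, SGDS.idealOf_mem_gaugeInvariantIdeals Y⟩
      -- `I` and the ideal of its zero set are both gauge-invariant with the same associated set, so
      -- they agree.
      left_inv I := Subtype.ext (SGDS.eq_of_isSetOf (SGDS.idealOf_mem_gaugeInvariantIdeals _) I.2
        (SGDS.isSetOf_idealOf _) (SGDS.isSetOf_zeroSet I.2.1))
      right_inv Y := by
        have h := SGDS.IsSetOf.eq_zeroSet Y.isClosed (SGDS.isSetOf_idealOf Y)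
        cases Y
        simp only [SGDS.ClosedInvariant.mk.injEq]
        exact h.symm }
  exact ⟨e, fun I => SGDS.isSetOf_zeroSet I.2.1, fun _ => rfl⟩
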